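/- **Setting.** Let $T$ be a set of sorts with a binary function $\to$, and let $\Sigma$ be an applicative signature: sets $\Sigma_{w,i}$ of symbols for $w\in T^*$, $i\in T$, with distinguished symbols $\cdot_{i,j}\in\Sigma_{(i\to j)\,i,\;j}$. For each sort $i$ let $\mathrm{Var}_i$ be a countably infinite set of variables. $\lambda$-terms are built from variables, the symbols of $\Sigma$, and the unary operators $\lambda x$ (sending terms of sort $j$ to terms of sort $i\to j$ for $x\in\mathrm{Var}_i$); terms are not identified up to renaming. $\mathsf{fv}$ and $\mathsf{bd}$ denote free and $\lambda$-bound variables, and $f^\flat(t)$, $t[s/x]$ replace free occurrences without renaming. For $w=i_1\cdots i_n$ put $w\to j:=i_1\to\cdots\to i_n\to j$. **Equations and deduction.** A quantitative $\lambda$-equation is an expression $t\simeq^X_\varepsilon s$ with $t,s$ of the same sort, $\varepsilon\in\mathbb Q_{\ge 0}$, and $X$ a finite set of variables (locally quantified in this equation). Its free variables are those of $\mathsf{fv}(t,s)\setminus X$. A consequence relation is a relation $\vdash$ between sets of equations and equations that is closed under (for all $\varepsilon,\delta\in\mathbb Q_{\ge0}$ and finite $X$): * (Cut) if $\Gamma\vdash\phi$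 for all $\phi\in\Gamma'$ and $\Gamma'\vdash\psi$, then $\Gamma\vdash\psi$; (Assumpt) $\Gamma\vdash\phi$ if $\phi\in\Gamma$; * (Refl) $\vdash t\simeq^X_0t$; (Symm) $t\simeq^X_\varepsilon s\vdash s\simeq^X_\varepsilon t$; (Triang) $t\simeq^X_\varepsilon s,\ s\simeq^X_\delta u\vdash t\simeq^X_{\varepsilon+\delta}u$; (Max) $t\simeq^X_\varepsilon s\vdash t\simeq^X_{\varepsilon+\delta}s$; (Arch) $\{t\simeq^X_\delta s\mid\delta>\varepsilon\}\vdash t\simeq^X_\varepsilon s$; * (NExp) $\{t_k\simeq^X_\varepsilon s_k\mid k\}\vdash\sigma(\vec t\,)\simeq^X_\varepsilon\sigma(\vec s\,)$ for every symbol $\sigma$ of $\Sigma$ (not for the operators $\lambda x$); * (Abstraction) $t\simeq^X_\varepsilon s\vdash t\simeq^{X'}_\varepsilon s$ if $X\subseteq X'$ and $\mathsf{fv}(t,s)\cap X'=\emptyset$; (Concretion) $t\simeq^X_\varepsilon s\vdash t\simeq^{X'}_\varepsilon s$ if $X'\subseteq X$; * (Subst) if $\Gamma\vdash t\simeq^X_\varepsilon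 s$, then $f^\flat(\Gamma)\vdash f^\flat(t)\simeq^X_\varepsilon f^\flat(s)$, where $f$ maps variables to terms of the same sort (and $f^\flat$ does not change the sets of locally quantified variables), provided that: $f$ is the identity on $X$ and on the locally quantified variables of each equation of $\Gamma$; for every variable $x\notin X$ that is free in the conclusion or in an equation of $\Gamma$, $\mathsf{fv}(f(x))\cap\mathsf{bd}(t,s,\Gamma)=\emptyset$; and, if $x\notin X$ is free in an equation $e\in\Gamma$, then $f(x)$ contains free no variable of $X$ and no locally quantified variable of $e$. An inference is a pair $\Gamma\vdash\phi$ with $\Gamma$ finite. For a set $S$ of inferences, let $\vdash_S$ be the smallest consequence relation that includes $S$; the theory generated by $S$ is the set of all inferences in $\vdash_S$, and a *theory* is a set of this form. $\mathcal U_\lambda$ is the theory generated by all instances (over all finite $X$) of * ($\alpha$) $\vdash\lambda x.t\simeq^X_0\lambda y.t[y/x]$, for $x,y$ of the same sort and $y$ not occurring (free or bound) in $\lambda x.t$; * ($\xi$) $t\simeq^X_\varepsilon u\vdash\lambda x.t\simeq^X_\varepsilon\lambda x.u$, for $x\in X$; * ($\beta$) $\vdash(\lambda x.t)u\simeq^X_0t[u/x]$,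 for $\mathsf{fv}(u)\cap\mathsf{bd}(t)=\emptyset$; and $\mathcal U_{\lambda\eta}$ is generated by these and ($\eta$) $\vdash t\simeq^X_0\lambda x.(tx)$ for $x\notin\mathsf{fv}(t)$. A quantitative (respectively extensional) $\lambda$-theory is a theory that includes $\mathcal U_\lambda$ (respectively $\mathcal U_{\lambda\eta}$). **Algebras.** Metrics are pseudo-metrics with values in $[0,\infty]$; tuples carry the maximum metric. A quantitative applicative $\lambda$-algebra $\mathcal A$ consists of metric spaces $(A_i,d_i)_{i\in T}$, a non-expansive map $\sigma_A:A_w\to A_i$ for each $\sigma\in\Sigma_{w,i}$, and maps $\Lambda_{w,j}$ from closed $\lambda$-terms of sort $w\to j$ with parameters in $A$ to $A_{w\to j}$. For $\rho:\mathrm{Var}\to A$ the interpretation $\rho^\natural$ is given by $\rho^\natural(x)=\rho(x)$, $\rho^\natural(\sigma(\vec t\,))=\sigma_A(\rho^\natural(\vec t\,))$, and $\rho^\natural(\lambda x.t)=\Lambda_{w*i,j}(\lambda\vec y\,\lambda x.t)\cdot\rho(\vec y)$, where $\vec y$ (of sorts $w$) lists the free variables of $\lambda x.t$, $x$ has sort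 $i$ and $t$ has sort $j$. $\mathrm{Met}^{\mathcal A}(A_w;A_j)$ is the set of non-expansive $h:A_w\to A_j$ such that $h(\vec a)=\Lambda_{w,j}(t_h)\cdot\vec a$ for some closed $t_h$; it carries $\Xi(f,g)=\inf\{\delta\mid\forall x,y\ \ d(f(x),g(y))\le\max\{\delta,d(x,y)\}\}$. $\mathcal A$ is a *quantitative $\lambda$-algebra* if these sets form a cartesian multicategory (they contain the projections and are closed under composition), and the maps $\boldsymbol\Lambda:\mathrm{Met}^{\mathcal A}(A_{w*i};A_j)\to\mathrm{Met}^{\mathcal A}(A_w;A_{i\to j})$, $\boldsymbol\Lambda(h)(\vec a)=\Lambda_{w*i,j}(t_h)\cdot\vec a$, and $\mathbf{Ev}:\mathrm{Met}^{\mathcal A}(A_w;A_{i\to j})\to\mathrm{Met}^{\mathcal A}(A_{w*i};A_j)$, $\mathbf{Ev}(f)(\vec a,b)=f(\vec a)\cdot b$, are well defined (independently of $t_h$), satisfy $\mathbf{Ev}\circ\boldsymbol\Lambda=\mathrm{id}$, are natural in $w$, and are non-expansive for $\Xi$. It is *extensional* if moreover $\boldsymbol\Lambda\circ\mathbf{Ev}=\mathrm{id}$.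 **Satisfaction.** An equation $t\simeq^X_\varepsilon s$ holds in $\mathcal A$ at $\rho$ if for any two families $\vec a,\vec b$ of values for the variables of $X$, with $\delta=\sup_{x\in X}d(a_x,b_x)$, one has $d\big(\rho_{X,\vec a}^\natural(t),\rho_{X,\vec b}^\natural(s)\big)\le\max\{\delta,\varepsilon\}$, where $\rho_{X,\vec a}$ is $\rho$ changed to $\vec a$ on $X$. $\Gamma\models_{\mathcal A}\phi$ means that, for every $\rho$, if all equations of $\Gamma$ hold at $\rho$, then $\phi$ holds at $\rho$. $\mathcal A\models\mathcal U$ means that $\Gamma\models_{\mathcal A}\phi$ for all inferences $\Gamma\vdash\phi$ in $\mathcal U$. **Theorem (soundness and completeness).** Let $\mathcal U$ be a quantitative $\lambda$-theory (respectively a quantitative extensional $\lambda$-theory), $\Gamma$ a finite set of quantitative $\lambda$-equations and $\phi$ a quantitative $\lambda$-equation. Then the inference $\Gamma\vdash\phi$ belongs to $\mathcal U$ if and only if $\Gamma\models_{\mathcal A}\phi$ for every quantitative $\lambda$-algebra (respectively quantitative extensional $\lambda$-algebra) $\mathcal A$ with $\mathcal A\models\mathcal U$. -/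

import Mathlib

open scoped NNReal ENNReal

universe u v w

namespace QLam

/-- Sorted variables: for each sort `i` the variables of sort `i` are the pairs `(i, n)`. -/
abbrev Var (T : Type u) : Type u := T × ℕ

/-- Applicative signatures: a set of sorts with a binary function `arr`, a family of symbols
indexed by arities and result sorts, and among the symbols the binary applications. -/
structure AppSig (T : Type u) where
  arr : T → T → T
  Sym : List T → T → Type v
  appSym : ∀ i j : T, Sym [arr i j, i] j

/-- The pair `(a, b)` as a tuple indexed by the two-element list `[i, j]`. -/
def pair {T : Type u} {F : T → Type w} {i j : T} (a : F i) (b : F j) :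
    ∀ k : Fin [i, j].length, F ([i, j].get k)
  | ⟨0, _⟩ => a
  | ⟨1, _⟩ => b

/-- Terms over the signature, the abstraction operators `λ x`, and the elements of a sorted
family `P` as additional constants. Terms are raw: bound variables have names. -/
inductive Tm {T : Type u} (S : AppSig.{u, v} T) (P : T → Type w) : T → Type (max u v w)
  | var (x : Var T) : Tm S P x.1
  | par {i : T} (a : P i) : Tm S P i
  | op {l : List T} {i : T} (σ : S.Sym l i) (ts : ∀ k : Fin l.length, Tm S P (l.get k)) :
      Tm S P i
  | lam {j : T} (x : Var T) (t : Tm S P j) : Tm S P (S.arr x.1 j)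

/-- The `λ`-terms: no additional constants. -/
abbrev LTm {T : Type u} (S : AppSig.{u, v} T) : T → Type (max u v) := Tm S (fun _ => Empty)

section Terms

variable {T : Type u} {S : AppSig.{u, v} T} {P : T → Type w}

/-- Application of terms. -/
def Tm.app {i j : T} (t : Tm S P (S.arr i j)) (s : Tm S P i) : Tm S P j :=
  Tm.op (S.appSym i j) (pair t s)

/-- Free variables. -/
def Tm.fv {i : T} : Tm S P i → Set (Var T)
  | .var x => {x}
  | .par _ => ∅
  | .op _ ts => ⋃ k, (ts k).fv
  | .lam x t => t.fv \ {x}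

/-- Bound variables. -/
def Tm.bd {i : T} : Tm S P i → Set (Var T)
  | .var _ => ∅
  | .par _ => ∅
  | .op _ ts => ⋃ k, (ts k).bd
  | .lam x t => insert x t.bd

open Classical in
/-- Replacement of the free occurrences of every variable `x` by `f x`. Bound variables are not
renamed; absence of capture is a side condition wherever this is used. -/
noncomputable def Tm.subst {i : T} (f : ∀ x : Var T, Tm S P x.1) : Tm S P i → Tm S P i
  | .var x => f x
  | .par a => .par a
  | .op σ ts => .op σ (fun k => (ts k).subst f)
  | .lam x t => .lam x (t.subst (Function.update f x (.var x)))

open Classical in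
/-- `t[s/x]`. -/
noncomputable def Tm.subst1 {i : T} (t : Tm S P i) (x : Var T) (s : Tm S P x.1) : Tm S P i :=
  t.subst (Function.update (fun y => .var y) x s)

open Classical in
/-- A repetition-free list of the free variables. -/
noncomputable def Tm.fvList {i : T} : Tm S P i → List (Var T)
  | .var x => [x]
  | .par _ => []
  | .op _ ts => ((List.ofFn fun k => (ts k).fvList).flatten).dedup
  | .lam x t => t.fvList.filter (fun y => y ≠ x)

theorem Tm.mem_fvList {i : T} (t : Tm S P i) (x : Var T) : x ∈ t.fvList ↔ x ∈ t.fv := by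
  induction t with
  | var y => simp [fvList, fv]
  | par a => simp [fvList, fv]
  | op σ ts ih => simp [fvList, fv, ← ih]
  | lam y t ih => simp [fvList, fv, ← ih]

/-- `λ`-terms seen as terms with additional constants. -/
def Tm.embed {i : T} (P : T → Type w) : LTm S i → Tm S P i
  | .var x => .var x
  | .par a => a.elim
  | .op σ ts => .op σ (fun k => (ts k).embed P)
  | .lam x t => .lam x (t.embed P)

theorem Tm.fv_embed {i : T} (t : LTm S i) : (t.embed P).fv = t.fv := by
  induction t with
  | var y => rfl
  | par a => exact a.elim
  | op σ ts ih => simp [embed, fv, ih]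
  | lam y t ih => simp [embed, fv, ih]

end Terms

section Contexts

variable {T : Type u}

/-- The sort `i₁ → ⋯ → iₙ → j`. A word `i₁ ⋯ iₙ` of argument sorts is written as the list
`[iₙ, …, i₁]`, last argument first, so that the word `w * i` is `i :: w`. -/
def arrs (S : AppSig.{u, v} T) : List T → T → T
  | [], j => j
  | i :: c, j => arrs S c (S.arr i j)

/-- Tuples of elements of a sorted family (same convention). -/
def Args (A : T → Type w) : List T → Type w
  | [] => PUnit
  | i :: c => Args A c × A i

variable {S : AppSig.{u, v} T} {P : T → Type w}

/-- `λ y₁ … λ yₙ. t`, where the list of variables is `[yₙ, …, y₁]`. -/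
def absList : ∀ (ys : List (Var T)) {j : T}, Tm S P j → Tm S P (arrs S (ys.map Prod.fst) j)
  | [], _, t => t
  | y :: ys, _, t => absList ys (Tm.lam y t)

theorem fv_absList (ys : List (Var T)) : ∀ {j : T} (t : Tm S P j),
    (absList ys t).fv = t.fv \ {y | y ∈ ys} := by
  induction ys with
  | nil =>
    intro j t
    ext x
    exact ⟨fun h => ⟨h, List.not_mem_nil⟩, fun h => h.1⟩
  | cons y ys ih =>
    intro j t
    refine (ih (Tm.lam y t)).trans ?_
    ext x
    simp [Tm.fv, and_assoc, not_or]

/-- The tuple of the values of a list of variables. -/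
def envArgs {A : T → Type w} (ρ : ∀ x : Var T, A x.1) :
    ∀ ys : List (Var T), Args A (ys.map Prod.fst)
  | [] => PUnit.unit
  | y :: ys => (envArgs ρ ys, ρ y)

/-- The closure `λ ȳ. λ x. t` of `λ x. t` with respect to its free variables `ȳ`, as a closed
term with constants from `P`. -/
noncomputable def closeLam (P : T → Type w) {j : T} (x : Var T) (t : LTm S j) :
    {s : Tm S P (arrs S ((x :: (Tm.lam x t).fvList).map Prod.fst) j) // s.fv = ∅} :=
  ⟨absList (x :: (Tm.lam x t).fvList) (t.embed P), by
    rw [fv_absList, Tm.fv_embed]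
    ext y
    have h := Tm.mem_fvList (Tm.lam x t) y
    constructor
    · rintro ⟨hy, hn⟩
      by_cases hx : y = x
      · exact hn (hx ▸ List.mem_cons_self)
      · exact hn (List.mem_cons_of_mem _ (h.2 ⟨hy, hx⟩))
    · exact fun hy => hy.elim⟩

end Contexts

section Deduction

variable {T : Type u}

/-- Quantitative `λ`-equations `lhs ≃_ε^X rhs` of a sort `i`; `X` is the finite set of locally
quantified variables. -/
structure QEq (S : AppSig.{u, v} T) where
  X : Finset (Var T)
  i : T
  lhs : LTm S i
  rhs : LTm S i
  ε : ℚ≥0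

variable {S : AppSig.{u, v} T}

/-- The free variables of an equation: those free in one of the two sides and not locally
quantified. -/
def QEq.fv (e : QEq S) : Set (Var T) := (e.lhs.fv ∪ e.rhs.fv) \ ↑e.X

/-- The variables bound by a `λ` in one of the two sides of an equation. -/
def QEq.bd (e : QEq S) : Set (Var T) := e.lhs.bd ∪ e.rhs.bd

/-- Substitution in both sides of an equation. -/
noncomputable def QEq.subst (f : ∀ x : Var T, LTm S x.1) (e : QEq S) : QEq S :=
  ⟨e.X, e.i, e.lhs.subst f, e.rhs.subst f, e.ε⟩

/-- The side condition of the substitution rule for `Γ ⊢ φ`.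

The substitution fixes the locally quantified variables of the conclusion, and the terms
substituted for other variables contain no variable that is bound by a `λ` in `Γ` or `φ`.
In the hypotheses the locally quantified variables are left alone as well, and the terms
substituted for the free variables of a hypothesis contain no variable that is locally quantified
in that hypothesis or in the conclusion. -/
structure SubstOK (f : ∀ x : Var T, LTm S x.1) (Γ : Set (QEq S)) (φ : QEq S) : Prop where
  fix : ∀ x ∈ φ.X, f x = .var x
  bound : ∀ e ∈ insert φ Γ, ∀ x ∈ e.fv, x ∉ φ.X →
    ∀ e' ∈ insert φ Γ, Disjoint (f x).fv e'.bd
  fix_hyp : ∀ e ∈ Γ, ∀ x ∈ e.X, f x = .var x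
  local_hyp : ∀ e ∈ Γ, ∀ x ∈ e.fv, x ∉ φ.X →
    Disjoint (f x).fv (↑e.X ∪ ↑φ.X)

/-- Inferences `Γ ⊢ φ` with finitely many hypotheses. -/
abbrev QInf (S : AppSig.{u, v} T) : Type (max u v) := Finset (QEq S) × QEq S

/-- The smallest consequence relation that includes the set `Ax` of inferences. -/
inductive Entails (Ax : Set (QInf S)) : Set (QEq S) → QEq S → Prop
  | ax {p : QInf S} : p ∈ Ax → Entails Ax ↑p.1 p.2
  | cut {Γ Γ' : Set (QEq S)} {ψ : QEq S} :
      (∀ φ ∈ Γ', Entails Ax Γ φ) → Entails Ax Γ' ψ → Entails Ax Γ ψ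
  | assumpt {Γ : Set (QEq S)} {φ : QEq S} : φ ∈ Γ → Entails Ax Γ φ
  | refl (X : Finset (Var T)) {i : T} (t : LTm S i) : Entails Ax ∅ ⟨X, i, t, t, 0⟩
  | symm (X : Finset (Var T)) {i : T} (t s : LTm S i) (ε : ℚ≥0) :
      Entails Ax {⟨X, i, t, s, ε⟩} ⟨X, i, s, t, ε⟩
  | triang (X : Finset (Var T)) {i : T} (t s r : LTm S i) (ε δ : ℚ≥0) :
      Entails Ax {⟨X, i, t, s, ε⟩, ⟨X, i, s, r, δ⟩} ⟨X, i, t, r, ε + δ⟩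
  | max (X : Finset (Var T)) {i : T} (t s : LTm S i) (ε δ : ℚ≥0) :
      Entails Ax {⟨X, i, t, s, ε⟩} ⟨X, i, t, s, ε + δ⟩
  | arch (X : Finset (Var T)) {i : T} (t s : LTm S i) (ε : ℚ≥0) :
      Entails Ax {e | ∃ δ : ℚ≥0, ε < δ ∧ e = ⟨X, i, t, s, δ⟩} ⟨X, i, t, s, ε⟩
  | nexp (X : Finset (Var T)) {l : List T} {i : T} (σ : S.Sym l i)
      (t s : ∀ k : Fin l.length, LTm S (l.get k)) (ε : ℚ≥0) :
      Entails Ax {e | ∃ k, e = ⟨X, l.get k, t k, s k, ε⟩} ⟨X, i, .op σ t, .op σ s, ε⟩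
  | subst {Γ : Set (QEq S)} {φ : QEq S} (f : ∀ x : Var T, LTm S x.1) :
      SubstOK f Γ φ → Entails Ax Γ φ → Entails Ax (QEq.subst f '' Γ) (φ.subst f)
  | abstraction (X X' : Finset (Var T)) {i : T} (t s : LTm S i) (ε : ℚ≥0) :
      X ⊆ X' → Disjoint (t.fv ∪ s.fv) ↑X' →
      Entails Ax {⟨X, i, t, s, ε⟩} ⟨X', i, t, s, ε⟩
  | concretion (X X' : Finset (Var T)) {i : T} (t s : LTm S i) (ε : ℚ≥0) :
      X' ⊆ X → Entails Ax {⟨X, i, t, s, ε⟩} ⟨X', i, t, s, ε⟩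

/-- The theory generated by a set of inferences. -/
def theoryOf (Ax : Set (QInf S)) : Set (QInf S) := {p | Entails Ax ↑p.1 p.2}

/-- The axioms (α), (ξ), (β). -/
inductive LamAx : QInf S → Prop
  | alpha (X : Finset (Var T)) (i : T) (n m : ℕ) {j : T} (t : LTm S j) :
      ((i, m) : Var T) ∉ (Tm.lam (i, n) t).fv ∪ (Tm.lam (i, n) t).bd →
      LamAx (∅, ⟨X, S.arr i j, .lam (i, n) t, .lam (i, m) (t.subst1 (i, n) (.var (i, m))), 0⟩)
  | xi (X : Finset (Var T)) (x : Var T) {j : T} (t s : LTm S j) (ε : ℚ≥0) : x ∈ X →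
      LamAx ({⟨X, j, t, s, ε⟩}, ⟨X, S.arr x.1 j, .lam x t, .lam x s, ε⟩)
  | beta (X : Finset (Var T)) (x : Var T) {j : T} (t : LTm S j) (s : LTm S x.1) :
      Disjoint s.fv t.bd →
      LamAx (∅, ⟨X, j, (Tm.lam x t).app s, t.subst1 x s, 0⟩)

/-- The axiom (η). -/
inductive EtaAx : QInf S → Prop
  | eta (X : Finset (Var T)) (x : Var T) {j : T} (t : LTm S (S.arr x.1 j)) : x ∉ t.fv →
      EtaAx (∅, ⟨X, S.arr x.1 j, t, .lam x (t.app (.var x)), 0⟩)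

/-- Quantitative theories. -/
def IsTheory (U : Set (QInf S)) : Prop := ∃ Ax : Set (QInf S), U = theoryOf Ax

/-- Quantitative `λ`-theories. -/
def IsLamTheory (U : Set (QInf S)) : Prop := IsTheory U ∧ theoryOf {p | LamAx p} ⊆ U

/-- Quantitative extensional `λ`-theories. -/
def IsExtLamTheory (U : Set (QInf S)) : Prop :=
  IsTheory U ∧ theoryOf {p | LamAx p ∨ EtaAx p} ⊆ U

end Deduction

/-- Quantitative applicative `λ`-algebras. Distances are pseudo-metrics with values in `[0, ∞]`,
operations are non-expansive for the maximum distance on tuples, and `closing c j` sends closed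
terms of sort `w → j` with parameters in the algebra to elements of that sort (`c` lists the word
`w`, last letter first). -/
structure AppAlg {T : Type u} (S : AppSig.{u, v} T) where
  carrier : T → Type w
  metric : ∀ i, PseudoEMetricSpace (carrier i)
  op : ∀ {l : List T} {i : T}, S.Sym l i → (∀ k : Fin l.length, carrier (l.get k)) → carrier i
  op_nonexp : ∀ {l : List T} {i : T} (σ : S.Sym l i) (a b : ∀ k : Fin l.length, carrier (l.get k)),
    edist (op σ a) (op σ b) ≤ ⨆ k, edist (a k) (b k)
  closing : ∀ (c : List T) (j : T), {t : Tm S carrier (arrs S c j) // t.fv = ∅} →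
    carrier (arrs S c j)

attribute [instance] AppAlg.metric

namespace AppAlg

variable {T : Type u} {S : AppSig.{u, v} T} (A : AppAlg.{u, v, w} S)

/-- Application. -/
def app {i j : T} (g : A.carrier (S.arr i j)) (a : A.carrier i) : A.carrier j :=
  A.op (S.appSym i j) (pair g a)

/-- Iterated application `g · a₁ ⋯ aₙ`. -/
def appArgs : ∀ (c : List T) {j : T}, A.carrier (arrs S c j) → Args A.carrier c → A.carrier j
  | [], _, g, _ => g
  | _ :: c, _, g, a => A.app (appArgs c g a.1) a.2

/-- The maximum distance on tuples. -/
noncomputable def argDist : ∀ c : List T, Args A.carrier c → Args A.carrier c → ℝ≥0∞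
  | [], _, _ => 0
  | _ :: c, a, b => max (argDist c a.1 b.1) (edist a.2 b.2)

/-- Interpretation of `λ`-terms under an assignment. -/
noncomputable def eval (ρ : ∀ x : Var T, A.carrier x.1) {i : T} : LTm S i → A.carrier i
  | .var x => ρ x
  | .par a => a.elim
  | .op σ ts => A.op σ (fun k => eval ρ (ts k))
  | .lam (j := j) x t =>
      A.appArgs ((Tm.lam x t).fvList.map Prod.fst)
        (A.closing (x.1 :: (Tm.lam x t).fvList.map Prod.fst) j (closeLam A.carrier x t))
        (envArgs ρ (Tm.lam x t).fvList)

/-- The function of the arguments in `c` represented by a closed term of sort `w → j`. -/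
def repr (c : List T) (j : T) (t : {t : Tm S A.carrier (arrs S c j) // t.fv = ∅}) :
    Args A.carrier c → A.carrier j :=
  A.appArgs c (A.closing c j t)

/-- The multi-arrows of the algebra: the representable non-expansive functions. -/
def Met (c : List T) (j : T) : Set (Args A.carrier c → A.carrier j) :=
  {f | (∀ a b, edist (f a) (f b) ≤ A.argDist c a b) ∧ ∃ t, f = A.repr c j t}

/-- Tuples of multi-arrows with common source. -/
def MetTuple (c' : List T) : ∀ c : List T, (Args A.carrier c' → Args A.carrier c) → Prop
  | [], _ => True
  | i :: c, g => MetTuple c' c (fun a => (g a).1) ∧ (fun a => (g a).2) ∈ A.Met c' i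

/-- The distance `Ξ` between functions. -/
noncomputable def Xi (c : List T) (j : T) (f g : Args A.carrier c → A.carrier j) : ℝ≥0∞ :=
  sInf {δ | ∀ x y, edist (f x) (g y) ≤ max δ (A.argDist c x y)}

/-- Evaluation: `(a, b) ↦ f a · b`. -/
def ev (c : List T) (i j : T) (f : Args A.carrier c → A.carrier (S.arr i j)) :
    Args A.carrier (i :: c) → A.carrier j :=
  fun a => A.app (f a.1) a.2

/-- `L` is the family of abstraction maps `h ↦ (a ↦ closing t_h · a)`, for any closed term `t_h`
that represents `h`. The representable functions form a cartesian multicategory, and abstraction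
and evaluation form a retraction, natural in the context and non-expansive for `Ξ`. -/
structure IsRetraction
    (L : ∀ (c : List T) (i j : T), (Args A.carrier (i :: c) → A.carrier j) →
      Args A.carrier c → A.carrier (S.arr i j)) : Prop where
  id_mem : ∀ c, A.MetTuple c c id
  comp_mem : ∀ (c c' : List T) (j : T) (f : Args A.carrier c → A.carrier j)
    (g : Args A.carrier c' → Args A.carrier c),
    f ∈ A.Met c j → A.MetTuple c' c g → f ∘ g ∈ A.Met c' j
  lam_eq : ∀ (c : List T) (i j : T) (t : {t : Tm S A.carrier (arrs S (i :: c) j) // t.fv = ∅}),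
    L c i j (A.repr (i :: c) j t) = A.appArgs c (A.closing (i :: c) j t)
  lam_mem : ∀ (c : List T) (i j : T), ∀ h ∈ A.Met (i :: c) j, L c i j h ∈ A.Met c (S.arr i j)
  ev_mem : ∀ (c : List T) (i j : T), ∀ f ∈ A.Met c (S.arr i j), A.ev c i j f ∈ A.Met (i :: c) j
  ev_lam : ∀ (c : List T) (i j : T), ∀ h ∈ A.Met (i :: c) j, A.ev c i j (L c i j h) = h
  lam_natural : ∀ (c c' : List T) (i j : T), ∀ h ∈ A.Met (i :: c) j,
    ∀ g : Args A.carrier c' → Args A.carrier c, A.MetTuple c' c g →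
    L c' i j (fun a => h (g a.1, a.2)) = L c i j h ∘ g
  ev_natural : ∀ (c c' : List T) (i j : T), ∀ f ∈ A.Met c (S.arr i j),
    ∀ g : Args A.carrier c' → Args A.carrier c, A.MetTuple c' c g →
    A.ev c' i j (f ∘ g) = fun a => A.ev c i j f (g a.1, a.2)
  lam_nonexp : ∀ (c : List T) (i j : T), ∀ h ∈ A.Met (i :: c) j, ∀ h' ∈ A.Met (i :: c) j,
    A.Xi c (S.arr i j) (L c i j h) (L c i j h') ≤ A.Xi (i :: c) j h h'
  ev_nonexp : ∀ (c : List T) (i j : T), ∀ f ∈ A.Met c (S.arr i j), ∀ f' ∈ A.Met c (S.arr i j),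
    A.Xi (i :: c) j (A.ev c i j f) (A.ev c i j f') ≤ A.Xi c (S.arr i j) f f'

/-- Quantitative `λ`-algebras. -/
def IsLamAlgebra : Prop := ∃ L, A.IsRetraction L

/-- Quantitative extensional `λ`-algebras: the retractions are isomorphisms. -/
def IsExtLamAlgebra : Prop :=
  ∃ L, A.IsRetraction L ∧
    ∀ (c : List T) (i j : T), ∀ f ∈ A.Met c (S.arr i j), L c i j (A.ev c i j f) = f

open Classical in
/-- The assignment that agrees with `a` on `X` and with `ρ` elsewhere. -/
noncomputable def override (X : Finset (Var T)) (ρ a : ∀ x : Var T, A.carrier x.1) :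
    ∀ x : Var T, A.carrier x.1 :=
  fun x => if x ∈ X then a x else ρ x

/-- Validity of an equation under `ρ`: for any two choices `a`, `b` of values for the locally
quantified variables, the distance of the two sides is at most `max (sup d(a, b)) ε`. -/
def HoldsAt (ρ : ∀ x : Var T, A.carrier x.1) (e : QEq S) : Prop :=
  ∀ a b : ∀ x : Var T, A.carrier x.1,
    edist (A.eval (A.override e.X ρ a) e.lhs) (A.eval (A.override e.X ρ b) e.rhs) ≤
      max (⨆ x ∈ e.X, edist (a x) (b x)) ((e.ε : ℝ≥0) : ℝ≥0∞)

/-- Satisfaction of an inference. -/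
def Sat (Γ : Set (QEq S)) (φ : QEq S) : Prop :=
  ∀ ρ : ∀ x : Var T, A.carrier x.1, (∀ e ∈ Γ, A.HoldsAt ρ e) → A.HoldsAt ρ φ

/-- Satisfaction of a theory. -/
def Models (U : Set (QInf S)) : Prop := ∀ p ∈ U, A.Sat ↑p.1 p.2

end AppAlg

end QLam

/-!
Soundness is immediate, because an algebra that satisfies a theory satisfies all its inferences.
Completeness rests on a term model. Fix a set `Ax` of inferences that generates the theory, and a
finite set `Γ` of hypotheses. The elements of the model are open terms modulo `Γ ⊢ t ≃_0^∅ s`, and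
the distance of `t` and `s` is the least `ε` such that `Γ ⊢ t ≃_ε^∅ s`. The free variables of `Γ`
act as constants; since `Γ` is finite, infinitely many variables of each sort remain generic.

* The model is weakly extensional, also quantitatively (`TermModel.edist_app_one_le`): if `g · b`
  and `g' · b` have distance at most `r` for all `b`, then so have `λ z. g z` and `λ z. g' z`. It
  suffices to take for `b` a variable `z` that is not free in `Γ`, because `Γ ⊢ t ≃_ε^∅ s` then
  implies `Γ ⊢ λ z. t ≃_ε^∅ λ z. s` (`HasLam.generalize`). For this, one adds a fresh locally
  quantified `x` and substitutes it for `z`; the substitution rule forbids this only if `z` is free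
  in a hypothesis.
* The functions represented by iterated application are closed under the operations, and thus
  under composition (`TermModel.rep_op`, `rep_comp`). For this, β-conversion with several arguments
  is needed (`HasLam.appEnv_absList_subst`). Since `(λ ȳ. r) ȳ = r` holds without side condition,
  it follows from the substitution rule, after bound variables have been renamed.
* Therefore terms with constants from the model can be interpreted by recursion, an abstraction
  being the element that represents the function it defines (`TermModel.interp`). This
  interpretation yields the structure map `closing`, and the model is a quantitative `λ`-algebra
  (`termAlg_isRetraction`), extensional if (η) is derivable (`termAlg_isExt`).
* An equation `t ≃_ε^X s` is interderivable with `λ x̄. t ≃_ε^∅ λ x̄. s`, where `x̄` lists `X`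
  (`HasLam.entails_closed`), and equivalent to it in the model (`termAlg_holdsAt_iff`). Moreover
  the interpretation of `t` at an assignment by the terms `f x` is the class of a substitution
  instance of a variant of `t` (`TermModel.exists_interp_eq_mk_subst`). So validity of an equation
  at an assignment is derivability from `Γ` of a substitution instance, and the model satisfies the
  theory by the substitution rule (`termAlg_models`). At the assignment of each variable to itself,
  the valid equations are exactly those derivable from `Γ`.
-/

namespace QLam

/-! ### Free variables and substitution in raw terms -/

section RawTerms

open scoped Classical

variable {T : Type u} {S : AppSig.{u, v} T} {P : T → Type w}

theorem Tm.finite_fv {i : T} (t : Tm S P i) : t.fv.Finite := by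
  induction t with
  | var x => exact Set.finite_singleton x
  | par a => exact Set.finite_empty
  | op σ ts ih => exact Set.finite_iUnion ih
  | lam x t ih => exact ih.subset Set.sdiff_subset

theorem Tm.finite_bd {i : T} (t : Tm S P i) : t.bd.Finite := by
  induction t with
  | var x => exact Set.finite_empty
  | par a => exact Set.finite_empty
  | op σ ts ih => exact Set.finite_iUnion ih
  | lam x t ih => exact ih.insert x

theorem exists_fresh {V : Set (Var T)} (hV : V.Finite) (i : T) : ∃ n : ℕ, ((i, n) : Var T) ∉ V :=
  (hV.preimage (f := fun n : ℕ => ((i, n) : Var T))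
    (fun _ _ _ _ h => (Prod.ext_iff.1 h).2)).exists_notMem

theorem Tm.subst_congr {i : T} (t : Tm S P i) : ∀ {f g : ∀ x : Var T, Tm S P x.1},
    (∀ x ∈ t.fv, f x = g x) → t.subst f = t.subst g := by
  induction t with
  | var x => exact fun h => h x rfl
  | par a => exact fun _ => rfl
  | op σ ts ih =>
    intro f g h
    simp only [subst]
    congr 1
    funext k
    exact ih k fun x hx => h x (Set.mem_iUnion.2 ⟨k, hx⟩)
  | lam x t ih =>
    intro f g h
    simp only [subst]
    congr 1
    refine ih fun y hy => ?_
    by_cases hyx : y = x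
    · subst hyx; simp
    · simp only [Function.update_of_ne hyx]
      exact h y ⟨hy, hyx⟩

theorem Tm.subst_var {i : T} (t : Tm S P i) : t.subst (fun x => .var x) = t := by
  induction t with
  | var x => rfl
  | par a => rfl
  | op σ ts ih => simp only [subst, ih]
  | lam x t ih => simp only [subst, Function.update_eq_self, ih]

theorem Tm.subst_eq_self {i : T} (t : Tm S P i) {f : ∀ x : Var T, Tm S P x.1}
    (h : ∀ x ∈ t.fv, f x = .var x) : t.subst f = t :=
  (t.subst_congr h).trans t.subst_var

/-- A substitution without capture: a variable free in `t` is either left alone, or replaced by a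
term none of whose free variables is bound in `t`. Leaving variables alone is allowed even if they
are also bound in `t`; this makes the condition pass under binders. -/
def Tm.NoCapture {i : T} (t : Tm S P i) (f : ∀ x : Var T, Tm S P x.1) : Prop :=
  ∀ x ∈ t.fv, f x = .var x ∨ Disjoint (f x).fv t.bd

theorem Tm.NoCapture.arg {l : List T} {i : T} {σ : S.Sym l i}
    {ts : ∀ k : Fin l.length, Tm S P (l.get k)} {f : ∀ x : Var T, Tm S P x.1}
    (h : (Tm.op σ ts).NoCapture f) (k : Fin l.length) : (ts k).NoCapture f := fun x hx =>
  (h x (Set.mem_iUnion.2 ⟨k, hx⟩)).imp_right fun hd =>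
    hd.mono_right (Set.subset_iUnion (fun k => (ts k).bd) k)

theorem Tm.NoCapture.body {j : T} {x : Var T} {t : Tm S P j} {f : ∀ x : Var T, Tm S P x.1}
    (h : (Tm.lam x t).NoCapture f) : t.NoCapture (Function.update f x (.var x)) := by
  intro y hy
  by_cases hyx : y = x
  · subst hyx; simp
  · simp only [Function.update_of_ne hyx]
    exact (h y ⟨hy, hyx⟩).imp_right fun hd => hd.mono_right (Set.subset_insert _ _)

theorem Tm.NoCapture.notMem {j : T} {x : Var T} {t : Tm S P j} {f : ∀ x : Var T, Tm S P x.1}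
    (h : (Tm.lam x t).NoCapture f) {y : Var T} (hy : y ∈ t.fv) (hyx : y ≠ x) :
    x ∉ (f y).fv := by
  rcases h y ⟨hy, hyx⟩ with h | h
  · rw [h]; exact fun hx => hyx hx.symm
  · exact fun hx => Set.disjoint_left.1 h hx (Set.mem_insert _ _)

theorem Tm.subst_subst {i : T} (t : Tm S P i) : ∀ {f g : ∀ x : Var T, Tm S P x.1},
    t.NoCapture f → (t.subst f).subst g = t.subst (fun x => (f x).subst g) := by
  induction t with
  | var x => exact fun _ => rfl
  | par a => exact fun _ => rfl
  | op σ ts ih =>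
    intro f g h
    simp only [subst]
    congr 1
    funext k
    exact ih k (h.arg k)
  | lam x t ih =>
    intro f g h
    simp only [subst]
    rw [ih h.body]
    congr 1
    refine t.subst_congr fun y hy => ?_
    by_cases hyx : y = x
    · subst hyx; simp [subst]
    · simp only [Function.update_of_ne hyx]
      refine (f y).subst_congr fun z hz => ?_
      exact Function.update_of_ne (fun hzx : z = x => h.notMem hy hyx (hzx ▸ hz)) _ _

theorem Tm.fv_subst {i : T} (t : Tm S P i) : ∀ {f : ∀ x : Var T, Tm S P x.1},
    t.NoCapture f → (t.subst f).fv = ⋃ x ∈ t.fv, (f x).fv := by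
  induction t with
  | var x => intro f _; simp [subst, fv]
  | par a => intro f _; simp [subst, fv]
  | op σ ts ih =>
    intro f h
    simp only [subst, fv, Set.biUnion_iUnion]
    exact Set.iUnion_congr fun k => ih k (h.arg k)
  | lam x t ih =>
    intro f h
    simp only [subst, fv]
    rw [ih h.body]
    ext z
    simp only [Set.mem_sdiff, Set.mem_iUnion, Set.mem_singleton_iff]
    constructor
    · rintro ⟨⟨y, hy, hz⟩, hzx⟩
      by_cases hyx : y = x
      · subst hyx; simp [fv] at hz; exact (hzx hz).elim
      · rw [Function.update_of_ne hyx] at hz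
        exact ⟨y, ⟨hy, hyx⟩, hz⟩
    · rintro ⟨y, ⟨hy, hyx⟩, hz⟩
      refine ⟨⟨y, hy, ?_⟩, fun hzx => h.notMem hy hyx (hzx ▸ hz)⟩
      rwa [Function.update_of_ne hyx]

theorem Tm.bd_subst_of_bd_eq_empty {i : T} (t : Tm S P i) : ∀ {f : ∀ x : Var T, Tm S P x.1},
    (∀ x, (f x).bd = ∅) → (t.subst f).bd = t.bd := by
  induction t with
  | var x => intro f h; simp [subst, bd, h]
  | par a => intro f _; rfl
  | op σ ts ih => intro f h; simp only [subst, bd, ih _ h]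
  | lam x t ih =>
    intro f h
    simp only [subst, bd]
    rw [ih]
    intro y
    by_cases hyx : y = x
    · subst hyx; simp [bd]
    · rw [Function.update_of_ne hyx, h]

theorem Tm.bd_subst1_var {i : T} (t : Tm S P i) (j : T) (n m : ℕ) :
    (t.subst1 (j, n) (.var (j, m))).bd = t.bd := by
  refine t.bd_subst_of_bd_eq_empty fun y => ?_
  by_cases hyx : y = (j, n)
  · subst hyx; simp [bd]
  · rw [Function.update_of_ne hyx]; rfl

theorem Tm.noCapture_subst1 {i : T} {t : Tm S P i} {x : Var T} {s : Tm S P x.1}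
    (h : Disjoint s.fv t.bd) : t.NoCapture (Function.update (fun y => .var y) x s) := by
  intro y _
  by_cases hyx : y = x
  · subst hyx; simp [h]
  · rw [Function.update_of_ne hyx]; exact Or.inl rfl

/-- Renaming a bound variable to a fresh one does not change the free variables. -/
theorem Tm.fv_lam_subst1_var {i : T} (t : Tm S P i) (j : T) (n m : ℕ)
    (hf : ((j, m) : Var T) ∉ t.fv) (hb : ((j, m) : Var T) ∉ t.bd) :
    (Tm.lam (j, m) (t.subst1 (j, n) (.var (j, m)))).fv = (Tm.lam (j, n) t).fv := by
  have hn : t.NoCapture (Function.update (fun y => .var y) (j, n) (.var (j, m))) :=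
    noCapture_subst1 (Set.disjoint_singleton_left.2 hb)
  simp only [fv, subst1]
  rw [fv_subst t hn]
  ext z
  simp only [Set.mem_sdiff, Set.mem_iUnion, Set.mem_singleton_iff]
  constructor
  · rintro ⟨⟨y, hy, hz⟩, hzm⟩
    by_cases hyx : y = (j, n)
    · subst hyx
      simp only [Function.update_self] at hz
      exact (hzm hz).elim
    · rw [Function.update_of_ne hyx] at hz
      obtain rfl : z = y := hz
      exact ⟨hy, hyx⟩
  · rintro ⟨hz, hzn⟩
    refine ⟨⟨z, hz, ?_⟩, fun h => hf (h ▸ hz)⟩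
    rw [Function.update_of_ne hzn]
    exact rfl

/-- Renaming `x` to a fresh `z` and then substituting is substituting for `x` directly. -/
theorem Tm.subst1_var_subst {i : T} (t : Tm S P i) (j : T) (n m : ℕ)
    (hf : ((j, m) : Var T) ∉ t.fv) (hb : ((j, m) : Var T) ∉ t.bd)
    (f : ∀ x : Var T, Tm S P x.1) (s : Tm S P j) :
    (t.subst1 (j, n) (.var (j, m))).subst (Function.update f (j, m) s)
      = t.subst (Function.update f (j, n) s) := by
  have hn : t.NoCapture (Function.update (fun y => .var y) (j, n) (.var (j, m))) :=
    noCapture_subst1 (Set.disjoint_singleton_left.2 hb)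
  rw [subst1, subst_subst t hn]
  refine t.subst_congr fun y hy => ?_
  by_cases hyx : y = (j, n)
  · subst hyx; simp [subst]
  · have : y ≠ (j, m) := fun h => hf (h ▸ hy)
    simp [Function.update_of_ne hyx, Function.update_of_ne this, subst]

/-- Application of a term to the values of a list of variables, as in `envArgs`. -/
def Tm.appEnv (f : ∀ x : Var T, Tm S P x.1) :
    ∀ (ys : List (Var T)) {j : T}, Tm S P (arrs S (ys.map Prod.fst) j) → Tm S P j
  | [], _, g => g
  | y :: ys, _, g => (Tm.appEnv f ys g).app (f y)

theorem Tm.fv_app {i j : T} (t : Tm S P (S.arr i j)) (s : Tm S P i) :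
    (t.app s).fv = t.fv ∪ s.fv := by
  ext x
  simp only [app, fv, Set.mem_iUnion, Set.mem_union]
  constructor
  · rintro ⟨⟨_ | _ | k, hk⟩, h⟩
    · exact Or.inl h
    · exact Or.inr h
    · simp at hk
  · rintro (h | h)
    · exact ⟨⟨0, by simp⟩, h⟩
    · exact ⟨⟨1, by simp⟩, h⟩

theorem Tm.bd_app {i j : T} (t : Tm S P (S.arr i j)) (s : Tm S P i) :
    (t.app s).bd = t.bd ∪ s.bd := by
  ext x
  simp only [app, bd, Set.mem_iUnion, Set.mem_union]
  constructor
  · rintro ⟨⟨_ | _ | k, hk⟩, h⟩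
    · exact Or.inl h
    · exact Or.inr h
    · simp at hk
  · rintro (h | h)
    · exact ⟨⟨0, by simp⟩, h⟩
    · exact ⟨⟨1, by simp⟩, h⟩

theorem Tm.subst_app {i j : T} (t : Tm S P (S.arr i j)) (s : Tm S P i)
    (f : ∀ x : Var T, Tm S P x.1) : (t.app s).subst f = (t.subst f).app (s.subst f) := by
  simp only [app, subst]
  congr 1
  funext k
  obtain ⟨_ | _ | k, hk⟩ := k
  · rfl
  · rfl
  · simp at hk

theorem Tm.fv_appEnv_var (ys : List (Var T)) : ∀ {j : T} (g : Tm S P (arrs S (ys.map Prod.fst) j)),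
    (g.appEnv (fun x => .var x) ys).fv = g.fv ∪ {y | y ∈ ys} := by
  induction ys with
  | nil => intro j g; ext x; exact ⟨Or.inl, fun h => h.elim id fun h => (List.not_mem_nil h).elim⟩
  | cons y ys ih =>
    intro j g
    have h : (g.appEnv (fun x => .var x) (y :: ys)).fv
      = (Tm.appEnv (fun x => .var x) ys g).fv ∪ {y} := fv_app _ _
    rw [h]
    refine (congrArg (· ∪ {y}) (ih (j := S.arr y.1 j) g)).trans ?_
    ext x
    simp only [Set.mem_union, Set.mem_ofPred_eq, Set.mem_singleton_iff, List.mem_cons]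
    tauto

theorem Tm.bd_appEnv_var (ys : List (Var T)) : ∀ {j : T} (g : Tm S P (arrs S (ys.map Prod.fst) j)),
    (g.appEnv (fun x => .var x) ys).bd = g.bd := by
  induction ys with
  | nil => intro j g; rfl
  | cons y ys ih =>
    intro j g
    have h : (g.appEnv (fun x => .var x) (y :: ys)).bd
      = (Tm.appEnv (fun x => .var x) ys g).bd ∪ ∅ := bd_app _ _
    rw [h, Set.union_empty]
    exact ih (j := S.arr y.1 j) g

theorem Tm.subst_appEnv_var (f : ∀ x : Var T, Tm S P x.1) (ys : List (Var T)) :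
    ∀ {j : T} (g : Tm S P (arrs S (ys.map Prod.fst) j)),
    (g.appEnv (fun x => .var x) ys).subst f = (g.subst f).appEnv f ys := by
  induction ys with
  | nil => intro j g; rfl
  | cons y ys ih =>
    intro j g
    refine (subst_app (Tm.appEnv (fun x => .var x) ys g) (.var y) f).trans ?_
    exact congrArg (fun t => Tm.app t (f y)) (ih (j := S.arr y.1 j) g)

end RawTerms

/-! ### Derived rules and provable equality -/

section Calculus

open scoped Classical

variable {T : Type u} {S : AppSig.{u, v} T} {Ax : Set (QInf S)}

namespace Entails

variable {Γ Δ : Set (QEq S)} {X : Finset (Var T)} {i j : T} {t s r t' s' : LTm S i} {ε δ : ℚ≥0}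

theorem mono {φ : QEq S} (h : Γ ⊆ Δ) (hφ : Entails Ax Γ φ) : Entails Ax Δ φ :=
  cut (fun _ hψ => assumpt (h hψ)) hφ

theorem of_singleton {e φ : QEq S} (h : Entails Ax {e} φ) (he : Entails Ax Γ e) :
    Entails Ax Γ φ :=
  cut (by rintro _ rfl; exact he) h

theorem refl' (Γ : Set (QEq S)) (X : Finset (Var T)) (t : LTm S i) :
    Entails Ax Γ ⟨X, i, t, t, 0⟩ :=
  mono (Set.empty_subset _) (refl X t)

theorem symm' (h : Entails Ax Γ ⟨X, i, t, s, ε⟩) : Entails Ax Γ ⟨X, i, s, t, ε⟩ :=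
  of_singleton (symm X t s ε) h

theorem trans' (h : Entails Ax Γ ⟨X, i, t, s, ε⟩) (h' : Entails Ax Γ ⟨X, i, s, r, δ⟩) :
    Entails Ax Γ ⟨X, i, t, r, ε + δ⟩ :=
  cut (by rintro _ (rfl | rfl); exacts [h, h']) (triang X t s r ε δ)

theorem weaken (h : Entails Ax Γ ⟨X, i, t, s, ε⟩) (hε : ε ≤ δ) :
    Entails Ax Γ ⟨X, i, t, s, δ⟩ := by
  have := of_singleton (max X t s ε (δ - ε)) h
  rwa [add_tsub_cancel_of_le hε] at this

theorem arch' (h : ∀ δ, ε < δ → Entails Ax Γ ⟨X, i, t, s, δ⟩) :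
    Entails Ax Γ ⟨X, i, t, s, ε⟩ :=
  cut (by rintro _ ⟨δ, hδ, rfl⟩; exact h δ hδ) (arch X t s ε)

theorem op' {l : List T} (σ : S.Sym l i) {ts ss : ∀ k : Fin l.length, LTm S (l.get k)}
    (h : ∀ k, Entails Ax Γ ⟨X, l.get k, ts k, ss k, ε⟩) :
    Entails Ax Γ ⟨X, i, .op σ ts, .op σ ss, ε⟩ :=
  cut (by rintro _ ⟨k, rfl⟩; exact h k) (nexp X σ ts ss ε)

theorem app' {a b : LTm S (S.arr i j)} (h : Entails Ax Γ ⟨X, S.arr i j, a, b, ε⟩)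
    (h' : Entails Ax Γ ⟨X, i, t, s, ε⟩) : Entails Ax Γ ⟨X, j, a.app t, b.app s, ε⟩ := by
  refine op' (S.appSym i j) fun k => ?_
  obtain ⟨_ | _ | k, hk⟩ := k
  · exact h
  · exact h'
  · simp at hk

theorem appEnv' (f : ∀ x : Var T, LTm S x.1) (ys : List (Var T)) : ∀ {j : T}
    {a b : LTm S (arrs S (ys.map Prod.fst) j)}, Entails Ax Γ ⟨X, _, a, b, ε⟩ →
    Entails Ax Γ ⟨X, j, a.appEnv f ys, b.appEnv f ys, ε⟩ := by
  induction ys with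
  | nil => exact fun h => h
  | cons y ys ih =>
    exact fun h => (ih (j := S.arr y.1 _) h).app' ((refl' Γ X (f y)).weaken (zero_le))

theorem concretion' {X' : Finset (Var T)} (h : Entails Ax Γ ⟨X, i, t, s, ε⟩) (hX : X' ⊆ X) :
    Entails Ax Γ ⟨X', i, t, s, ε⟩ :=
  of_singleton (concretion X X' t s ε hX) h

theorem abstraction' {X' : Finset (Var T)} (h : Entails Ax Γ ⟨X, i, t, s, ε⟩) (hX : X ⊆ X')
    (hd : Disjoint (t.fv ∪ s.fv) ↑X') : Entails Ax Γ ⟨X', i, t, s, ε⟩ :=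
  of_singleton (abstraction X X' t s ε hX hd) h

end Entails

/-- The derivability of the axioms (α), (ξ), (β). -/
def HasLam (Ax : Set (QInf S)) : Prop := ∀ p, LamAx p → Entails Ax ↑p.1 p.2

/-- Provable equality, uniformly in the set of locally quantified variables. Because of this
uniformity it is a congruence for abstraction over every variable. -/
def ProvEq (Ax : Set (QInf S)) {i : T} (t s : LTm S i) : Prop :=
  ∀ X : Finset (Var T), Entails Ax ∅ ⟨X, i, t, s, 0⟩

namespace ProvEq

variable {i j : T} {t s r : LTm S i}

theorem refl (t : LTm S i) : ProvEq Ax t t := fun X => Entails.refl X t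

theorem symm (h : ProvEq Ax t s) : ProvEq Ax s t := fun X => (h X).symm'

theorem trans (h : ProvEq Ax t s) (h' : ProvEq Ax s r) : ProvEq Ax t r := fun X => by
  simpa using (h X).trans' (h' X)

theorem op {l : List T} (σ : S.Sym l i) {ts ss : ∀ k : Fin l.length, LTm S (l.get k)}
    (h : ∀ k, ProvEq Ax (ts k) (ss k)) : ProvEq Ax (Tm.op σ ts) (Tm.op σ ss) :=
  fun X => Entails.op' σ fun k => h k X

theorem app {a b : LTm S (S.arr i j)} (h : ProvEq Ax a b) (h' : ProvEq Ax t s) :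
    ProvEq Ax (a.app t) (b.app s) :=
  fun X => (h X).app' (h' X)

theorem appEnv (f : ∀ x : Var T, LTm S x.1) (ys : List (Var T)) : ∀ {j : T}
    {a b : LTm S (arrs S (ys.map Prod.fst) j)}, ProvEq Ax a b →
    ProvEq Ax (a.appEnv f ys) (b.appEnv f ys) := by
  induction ys with
  | nil => exact fun h => h
  | cons y ys ih => exact fun h => (ih (j := S.arr y.1 _) h).app (refl _)

theorem entails (h : ProvEq Ax t s) (Γ : Set (QEq S)) (X : Finset (Var T)) :
    Entails Ax Γ ⟨X, i, t, s, 0⟩ :=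
  (h X).mono (Set.empty_subset _)

end ProvEq

theorem Entails.congr {Γ : Set (QEq S)} {X : Finset (Var T)} {i : T} {t s t' s' : LTm S i}
    {ε : ℚ≥0} (h : Entails Ax Γ ⟨X, i, t, s, ε⟩) (ht : ProvEq Ax t t') (hs : ProvEq Ax s s') :
    Entails Ax Γ ⟨X, i, t', s', ε⟩ := by
  simpa using ((ht.symm.entails Γ X).trans' h).trans' (hs.entails Γ X)

/-- Derivable equations are closed under substitution into terms without hypotheses. -/
theorem Entails.subst_empty {i : T} {ε : ℚ≥0} {t s : LTm S i} (f : ∀ x : Var T, LTm S x.1)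
    (h : Entails Ax ∅ ⟨∅, i, t, s, ε⟩)
    (hf : ∀ x ∈ t.fv ∪ s.fv, Disjoint (f x).fv (t.bd ∪ s.bd)) :
    Entails Ax ∅ ⟨∅, i, t.subst f, s.subst f, ε⟩ := by
  have := Entails.subst f ⟨by simp, ?_, by simp, by simp⟩ h
  · simpa [QEq.subst] using this
  · rintro e (rfl | he) x hx - e' (rfl | he')
    · exact hf x hx.1
    · exact he'.elim
    · exact he.elim
    · exact he.elim

namespace HasLam

variable {Γ : Set (QEq S)} {X : Finset (Var T)} {i j : T} {ε : ℚ≥0}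

theorem xi (H : HasLam Ax) {x : Var T} {t s : LTm S j} (hx : x ∈ X)
    (h : Entails Ax Γ ⟨X, j, t, s, ε⟩) :
    Entails Ax Γ ⟨X, S.arr x.1 j, .lam x t, .lam x s, ε⟩ :=
  Entails.of_singleton (by simpa using H _ (LamAx.xi X x t s ε hx)) h

theorem beta (H : HasLam Ax) (x : Var T) (t : LTm S j) (s : LTm S x.1) (h : Disjoint s.fv t.bd) :
    ProvEq Ax ((Tm.lam x t).app s) (t.subst1 x s) := fun X => by
  simpa using H _ (LamAx.beta X x t s h)

theorem alpha (H : HasLam Ax) (i : T) (n m : ℕ) (t : LTm S j) (hf : ((i, m) : Var T) ∉ t.fv)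
    (hb : ((i, m) : Var T) ∉ t.bd) :
    ProvEq Ax (Tm.lam (i, n) t) (Tm.lam (i, m) (t.subst1 (i, n) (.var (i, m)))) := by
  by_cases hmn : m = n
  · subst hmn
    have : t.subst1 (i, m) (.var (i, m)) = t :=
      t.subst_eq_self fun x hx => Function.update_of_ne (fun h : x = (i, m) => hf (h ▸ hx)) _ _
    rw [this]
    exact ProvEq.refl _
  · intro X
    have hm : ((i, m) : Var T) ∉ (Tm.lam (i, n) t).fv ∪ (Tm.lam (i, n) t).bd := by
      rintro (h | h | h)
      · exact hf h.1
      · exact hmn (Prod.ext_iff.1 h).2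
      · exact hb h
    simpa using H _ (LamAx.alpha X i n m t hm)

theorem lam (H : HasLam Ax) {x : Var T} {t s : LTm S j} (h : ProvEq Ax t s) :
    ProvEq Ax (Tm.lam x t) (Tm.lam x s) := fun X =>
  (H.xi (Finset.mem_insert_self x X) (h _)).concretion' (Finset.subset_insert _ _)

/-- Every term is provably equal to one in which no variable of a given finite set is bound. -/
theorem exists_rename (H : HasLam Ax) {V : Set (Var T)} (hV : V.Finite) (t : LTm S i) :
    ∃ t', ProvEq Ax t t' ∧ t'.fv = t.fv ∧ Disjoint t'.bd V := by
  induction t with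
  | var x => exact ⟨_, ProvEq.refl _, rfl, Set.empty_disjoint _⟩
  | par a => exact a.elim
  | op σ ts ih =>
    choose ts' h₁ h₂ h₃ using ih
    refine ⟨.op σ ts', ProvEq.op σ h₁, ?_, Set.disjoint_iUnion_left.2 h₃⟩
    exact Set.iUnion_congr h₂
  | lam x t ih =>
    obtain ⟨t', h₁, h₂, h₃⟩ := ih
    obtain ⟨m, hm⟩ := exists_fresh ((t'.finite_fv.union t'.finite_bd).union hV) x.1
    rw [Set.mem_union, Set.mem_union, not_or, not_or] at hm
    refine ⟨.lam (x.1, m) (t'.subst1 x (.var (x.1, m))),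
      (H.lam h₁).trans (H.alpha x.1 x.2 m t' hm.1.1 hm.1.2),
      (t'.fv_lam_subst1_var x.1 x.2 m hm.1.1 hm.1.2).trans (by simp only [Tm.fv, h₂]), ?_⟩
    refine Set.disjoint_insert_left.2 ⟨hm.2, ?_⟩
    rw [Tm.bd_subst1_var t' x.1 x.2 m]
    exact h₃

/-- Applying an abstraction to its own variable needs no side condition. -/
theorem beta_var (H : HasLam Ax) (x : Var T) (t : LTm S j) :
    ProvEq Ax ((Tm.lam x t).app (.var x)) t := by
  obtain ⟨t', h₁, -, h₃⟩ := H.exists_rename (Set.finite_singleton x) t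
  have h := H.beta x t' (.var x) h₃.symm
  rw [Tm.subst1, Function.update_eq_self, Tm.subst_var] at h
  exact (((H.lam h₁).app (ProvEq.refl _)).trans h).trans h₁.symm

theorem appEnv_absList (H : HasLam Ax) (ys : List (Var T)) : ∀ {j : T} (r : LTm S j),
    ProvEq Ax ((absList ys r).appEnv (fun x => .var x) ys) r := by
  induction ys with
  | nil => exact fun r => ProvEq.refl r
  | cons y ys ih =>
    exact fun r => ((ih (Tm.lam y r)).app (ProvEq.refl _)).trans (H.beta_var y r)

/-- Simultaneous β-conversion, for a variant `r'` of `r` in which nothing is captured. It comes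
from the case `f = var`, which needs no side condition, by the substitution rule. -/
theorem appEnv_absList_subst (H : HasLam Ax) (ys : List (Var T)) (f : ∀ x : Var T, LTm S x.1)
    (hfy : ∀ x ∉ ys, f x = .var x) (r r' : LTm S j) (hr : ProvEq Ax r r')
    (hfv : r'.fv = r.fv) (hn : ∀ x ∈ r.fv ∪ {y | y ∈ ys}, Disjoint (f x).fv r'.bd) :
    Entails Ax ∅ ⟨∅, j, (absList ys r).appEnv f ys, r'.subst f, 0⟩ := by
  have hV : (⋃ x ∈ r.fv ∪ {y | y ∈ ys}, (f x).fv).Finite :=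
    (r.finite_fv.union ys.finite_toSet).biUnion fun x _ => (f x).finite_fv
  -- The variables `ys` are bound in `absList ys r`, so this closure needs a variant as well.
  obtain ⟨q, hq, hqf, hqb⟩ := H.exists_rename hV (absList ys r)
  have h1 : ProvEq Ax (q.appEnv (fun x => .var x) ys) r' :=
    ((hq.symm.appEnv _ ys).trans (H.appEnv_absList ys r)).trans hr
  have h2 := (h1 ∅).subst_empty f (by
    intro x hx
    have hx' : x ∈ r.fv ∪ {y | y ∈ ys} := by
      rw [Tm.fv_appEnv_var, hqf, fv_absList, hfv] at hx
      rcases hx with (hx | hx) | hx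
      · exact Or.inl hx.1
      · exact Or.inr hx
      · exact Or.inl hx
    rw [Tm.bd_appEnv_var]
    exact Set.disjoint_union_right.2
      ⟨(hqb.mono_right (Set.subset_biUnion_of_mem (u := fun x => (f x).fv) hx')).symm, hn x hx'⟩)
  rw [Tm.subst_appEnv_var, q.subst_eq_self] at h2
  · exact h2.congr (hq.symm.appEnv f ys) (ProvEq.refl _)
  · intro x hx
    rw [hqf, fv_absList] at hx
    exact hfy x hx.2

end HasLam

end Calculus

/-! ### Local quantification, and abstraction over fresh variables -/

section Closure

open scoped Classical

variable {T : Type u} {S : AppSig.{u, v} T} {Ax : Set (QInf S)}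

/-- The equation `λ x₁ … λ xₙ. t ≃_ε^∅ λ x₁ … λ xₙ. s`, where `X = {x₁, …, xₙ}`. It is
interderivable with `t ≃_ε^X s` and has no locally quantified variables. -/
noncomputable def QEq.closed (e : QEq S) : QEq S :=
  ⟨∅, _, absList e.X.toList e.lhs, absList e.X.toList e.rhs, e.ε⟩

theorem QEq.fv_closed (e : QEq S) : e.closed.fv = e.fv := by
  ext x
  simp [closed, fv, fv_absList, or_and_right]

theorem QEq.finite_fv (e : QEq S) : e.fv.Finite :=
  (e.lhs.finite_fv.union e.rhs.finite_fv).subset Set.sdiff_subset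

namespace HasLam

theorem xi_absList (H : HasLam Ax) {Γ : Set (QEq S)} {X : Finset (Var T)} {ε : ℚ≥0}
    (xs : List (Var T)) (hxs : ∀ x ∈ xs, x ∈ X) : ∀ {j : T} {t s : LTm S j},
    Entails Ax Γ ⟨X, j, t, s, ε⟩ → Entails Ax Γ ⟨X, _, absList xs t, absList xs s, ε⟩ := by
  induction xs with
  | nil => exact fun h => h
  | cons x xs ih =>
    exact fun h => ih (fun y hy => hxs y (List.mem_cons_of_mem _ hy))
      (H.xi (hxs x List.mem_cons_self) h)

theorem entails_closed (H : HasLam Ax) {Γ : Set (QEq S)} {e : QEq S} :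
    Entails Ax Γ e.closed ↔ Entails Ax Γ e := by
  constructor
  · -- The closed sides contain no variable of `X`, so `X` can be quantified again.
    intro h
    have h₁ := h.abstraction' (X' := e.X) (Finset.empty_subset _) (by
      rw [fv_absList, fv_absList]
      refine Set.disjoint_left.2 ?_
      rintro x (hx | hx) hX <;> exact hx.2 (Finset.mem_toList.2 hX))
    exact (h₁.appEnv' (fun x => .var x) _).congr (H.appEnv_absList _ _) (H.appEnv_absList _ _)
  · intro h
    exact (H.xi_absList e.X.toList (fun x hx => Finset.mem_toList.1 hx) h).concretion'
      (Finset.empty_subset _)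

/-- Every equation is interderivable with one without locally quantified variables and in which
no variable of a given finite set is bound. -/
theorem exists_closed_rename (H : HasLam Ax) {V : Set (Var T)} (hV : V.Finite) (e : QEq S) :
    ∃ e' : QEq S, e'.X = ∅ ∧ e'.fv = e.fv ∧ Disjoint e'.bd V ∧
      ∀ Γ, Entails Ax Γ e' ↔ Entails Ax Γ e := by
  obtain ⟨l, hl, hlf, hlb⟩ := H.exists_rename hV e.closed.lhs
  obtain ⟨r, hr, hrf, hrb⟩ := H.exists_rename hV e.closed.rhs
  refine ⟨⟨∅, _, l, r, e.ε⟩, rfl, ?_, Set.disjoint_union_left.2 ⟨hlb, hrb⟩, fun Γ => ?_⟩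
  · rw [← e.fv_closed]
    simp only [QEq.fv, hlf, hrf]
    rfl
  · rw [← H.entails_closed (e := e)]
    exact ⟨fun h => h.congr hl.symm hr.symm, fun h => Entails.congr h hl hr⟩

/-- Abstraction over a variable `z` that is not free in the hypotheses. Locally quantify a fresh
`x`, replace `z` by `x`, which the substitution rule permits because `z` is free only in the
conclusion, and apply (ξ) and (α). -/
theorem generalize (H : HasLam Ax) {Γ : Set (QEq S)} (hΓ : (⋃ e ∈ Γ, e.fv).Finite) {i : T}
    {t s : LTm S i} {ε : ℚ≥0} (z : Var T) (hz : ∀ e ∈ Γ, z ∉ e.fv)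
    (h : Entails Ax Γ ⟨∅, i, t, s, ε⟩) :
    Entails Ax Γ ⟨∅, S.arr z.1 i, .lam z t, .lam z s, ε⟩ := by
  have hW : (insert z (t.fv ∪ s.fv ∪ ⋃ e ∈ Γ, e.fv)).Finite :=
    ((t.finite_fv.union s.finite_fv).union hΓ).insert z
  obtain ⟨m, hm⟩ := exists_fresh hW z.1
  obtain ⟨x, rfl⟩ : ∃ x : Var T, x = (z.1, m) := ⟨_, rfl⟩
  have hV := hW.insert (z.1, m)
  -- The substitution rule requires that no variable free in a substituted term is bound in the
  -- conclusion or in a hypothesis; so the hypotheses, too, are replaced by variants `v e`.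
  choose v hvX hvfv hvbd hv using fun e : QEq S => H.exists_closed_rename hV e
  obtain ⟨t', ht, htf, htb⟩ := H.exists_rename hV t
  obtain ⟨s', hs, hsf, hsb⟩ := H.exists_rename hV s
  simp only [Set.mem_insert_iff, Set.mem_union, Set.mem_iUnion, not_or, not_exists] at hm
  obtain ⟨hxz, ⟨hxt, hxs⟩, hxΓ⟩ := hm
  have h₁ : Entails Ax (v '' Γ) ⟨∅, i, t', s', ε⟩ := by
    refine (Entails.cut (fun e he => ?_) h).congr ht hs
    exact (hv e _).1 (Entails.assumpt ⟨e, he, rfl⟩)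
  have h₂ := h₁.abstraction' (X' := {(z.1, m)}) (Finset.empty_subset _) (by
    rw [htf, hsf]
    simpa using ⟨hxt, hxs⟩)
  have hmem : ∀ e ∈ insert (⟨{(z.1, m)}, i, t', s', ε⟩ : QEq S) (v '' Γ),
      Disjoint e.bd (insert (z.1, m) (insert z (t.fv ∪ s.fv ∪ ⋃ e ∈ Γ, e.fv))) := by
    rintro e (rfl | ⟨e, he, rfl⟩)
    · exact Set.disjoint_union_left.2 ⟨htb, hsb⟩
    · exact hvbd e
  have h₃ := Entails.subst (Function.update (fun y => .var y) z (.var (z.1, m))) ⟨?_, ?_, ?_, ?_⟩ h₂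
  · have h₄ : Entails Ax Γ ⟨{(z.1, m)}, i, t'.subst1 z (.var (z.1, m)),
        s'.subst1 z (.var (z.1, m)), ε⟩ := by
      refine Entails.cut ?_ h₃
      rintro _ ⟨_, ⟨e, he, rfl⟩, rfl⟩
      -- Since `z` is not free in `v e`, the substitution does not change this hypothesis.
      have hself : ∀ y ∈ (v e).lhs.fv ∪ (v e).rhs.fv,
          Function.update (fun y => Tm.var y) z (.var (z.1, m)) y
            = (.var y : LTm S y.1) := by
        intro y hy
        refine Function.update_of_ne (fun hyz : y = z => hz e he ?_) _ _
        rw [← hvfv, ← hyz]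
        exact ⟨hy, by simp [hvX]⟩
      have : QEq.subst (Function.update (fun y => .var y) z (.var (z.1, m))) (v e) = v e := by
        rw [QEq.subst, Tm.subst_eq_self _ fun y hy => hself y (Or.inl hy),
          Tm.subst_eq_self _ fun y hy => hself y (Or.inr hy)]
      rw [this]
      exact (hv e _).2 (Entails.assumpt he)
    have hbt : ((z.1, m) : Var T) ∉ t'.bd := fun hb =>
      Set.disjoint_left.1 htb hb (Set.mem_insert _ _)
    have hbs : ((z.1, m) : Var T) ∉ s'.bd := fun hb =>
      Set.disjoint_left.1 hsb hb (Set.mem_insert _ _)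
    have h₅ := (H.xi (Finset.mem_singleton_self _) h₄).concretion' (Finset.empty_subset _)
    exact h₅.congr
      (((H.lam ht).trans (H.alpha z.1 z.2 m t' (htf ▸ hxt) hbt)).symm)
      (((H.lam hs).trans (H.alpha z.1 z.2 m s' (hsf ▸ hxs) hbs)).symm)
  · intro x hx
    obtain rfl := Finset.mem_singleton.1 hx
    exact Function.update_of_ne hxz _ _
  · intro e he y hy _ e' he'
    refine ((hmem e' he').mono_right ?_).symm
    by_cases hyz : y = z
    · subst hyz
      rw [Function.update_self]
      exact Set.singleton_subset_iff.2 (Set.mem_insert _ _)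
    · rw [Function.update_of_ne hyz]
      refine Set.singleton_subset_iff.2 (Set.mem_insert_of_mem _ (Set.mem_insert_of_mem _ ?_))
      rcases he with rfl | ⟨e, he, rfl⟩
      · rcases hy.1 with hy | hy
        · exact Or.inl (Or.inl (htf ▸ hy))
        · exact Or.inl (Or.inr (hsf ▸ hy))
      · rw [hvfv] at hy
        exact Or.inr (Set.mem_biUnion he hy)
  · rintro _ ⟨e, he, rfl⟩ x hx
    simp [hvX] at hx
  · rintro _ ⟨e, he, rfl⟩ y hy _
    rw [hvfv] at hy
    rw [hvX, Function.update_of_ne (fun h : y = z => hz e he (h ▸ hy))]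
    simp only [Finset.coe_empty, Set.empty_union, Finset.coe_singleton]
    exact Set.disjoint_singleton.2 fun h : y = (z.1, m) => hxΓ e he (h ▸ hy)

end HasLam

end Closure

/-! ### The term model and its representable functions -/

section TermModel

open scoped Classical

variable {T : Type u} {S : AppSig.{u, v} T}

theorem ennreal_le_of_forall_nnrat {a b : ℝ≥0∞}
    (h : ∀ q : ℚ≥0, b ≤ ((q : ℝ≥0) : ℝ≥0∞) → a ≤ ((q : ℝ≥0) : ℝ≥0∞)) : a ≤ b := by
  refine le_of_forall_gt_imp_ge_of_dense fun c hc => ?_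
  obtain ⟨q, hq, h₁, h₂⟩ := ENNReal.lt_iff_exists_rat_btwn.1 hc
  lift q to ℚ≥0 using hq
  have hcast : ((Real.toNNReal ((q : ℚ) : ℝ) : ℝ≥0) : ℝ≥0∞) = ((q : ℝ≥0) : ℝ≥0∞) := by
    congr 1
    apply NNReal.eq
    rw [Real.coe_toNNReal _ (by positivity)]
    rfl
  rw [hcast] at h₁ h₂
  exact (h q h₁.le).trans h₂.le

theorem envArgs_congr {A : T → Type w} {ρ ρ' : ∀ x : Var T, A x.1} {ys : List (Var T)}
    (h : ∀ y ∈ ys, ρ y = ρ' y) : envArgs ρ ys = envArgs ρ' ys := by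
  induction ys with
  | nil => rfl
  | cons y ys ih =>
    simp only [envArgs]
    rw [h y List.mem_cons_self, ih fun z hz => h z (List.mem_cons_of_mem _ hz)]

theorem exists_fresh_list {V : Set (Var T)} (hV : V.Finite) (c : List T) :
    ∃ ys : List (Var T), ys.map Prod.fst = c ∧ ys.Nodup ∧ ∀ y ∈ ys, y ∉ V := by
  induction c with
  | nil => exact ⟨[], rfl, List.nodup_nil, by simp⟩
  | cons i c ih =>
    obtain ⟨ys, h₁, h₂, h₃⟩ := ih
    obtain ⟨n, hn⟩ := exists_fresh (hV.union ys.finite_toSet) i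
    rw [Set.mem_union, not_or] at hn
    refine ⟨(i, n) :: ys, by simp [h₁], List.nodup_cons.2 ⟨hn.2, h₂⟩, ?_⟩
    intro y hy
    rcases List.mem_cons.1 hy with rfl | hy
    · exact hn.1
    · exact h₃ y hy

/-- Equality of terms, provable from the hypotheses `Γ`. -/
def termSetoid (Ax : Set (QInf S)) (Γ : Set (QEq S)) (i : T) : Setoid (LTm S i) where
  r t s := Entails Ax Γ ⟨∅, i, t, s, 0⟩
  iseqv := ⟨fun t => Entails.refl' Γ ∅ t, fun h => h.symm', fun h h' => by
    simpa using h.trans' h'⟩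

/-- The carriers of the term model: open terms modulo provable equality from `Γ`. -/
def TermModel (Ax : Set (QInf S)) (Γ : Set (QEq S)) (i : T) : Type (max u v) :=
  Quotient (termSetoid Ax Γ i)

/-- The least `ε` such that `t ≃_ε^∅ s` is derivable from `Γ`, or `∞` if there is none. -/
noncomputable def termDist (Ax : Set (QInf S)) (Γ : Set (QEq S)) {i : T} (t s : LTm S i) :
    ℝ≥0∞ :=
  ⨅ (q : ℚ≥0) (_ : Entails Ax Γ ⟨∅, i, t, s, q⟩), ((q : ℝ≥0) : ℝ≥0∞)

variable {Ax : Set (QInf S)} {Γ : Set (QEq S)}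

theorem termDist_le_iff {i : T} {t s : LTm S i} {q : ℚ≥0} :
    termDist Ax Γ t s ≤ ((q : ℝ≥0) : ℝ≥0∞) ↔ Entails Ax Γ ⟨∅, i, t, s, q⟩ := by
  constructor
  · intro h
    refine Entails.arch' fun δ hδ => ?_
    have : termDist Ax Γ t s < ((δ : ℝ≥0) : ℝ≥0∞) :=
      h.trans_lt (by exact_mod_cast hδ)
    simp only [termDist, iInf_lt_iff] at this
    obtain ⟨q', hq', hlt⟩ := this
    exact hq'.weaken (le_of_lt (by exact_mod_cast hlt))
  · exact fun h => iInf₂_le q h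

theorem termDist_comm {i : T} (t s : LTm S i) : termDist Ax Γ t s = termDist Ax Γ s t :=
  le_antisymm
    (ennreal_le_of_forall_nnrat fun _ h => termDist_le_iff.2 (termDist_le_iff.1 h).symm')
    (ennreal_le_of_forall_nnrat fun _ h => termDist_le_iff.2 (termDist_le_iff.1 h).symm')

noncomputable instance (i : T) : PseudoEMetricSpace (TermModel Ax Γ i) where
  edist a b := termDist Ax Γ a.out b.out
  edist_self a := by
    refine le_antisymm ?_ bot_le
    simpa using termDist_le_iff.2 (Entails.refl' (Ax := Ax) Γ ∅ a.out)
  edist_comm a b := termDist_comm _ _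
  edist_triangle a b c := by
    conv_rhs => rw [termDist, termDist]
    simp only [ENNReal.iInf_add, ENNReal.add_iInf]
    refine le_iInf₂ fun q hq => le_iInf₂ fun q' hq' => ?_
    have := termDist_le_iff.2 (hq'.trans' hq)
    push_cast at this
    exact this

namespace TermModel

variable {i j : T}

/-- The class of a term. -/
def mk (Ax : Set (QInf S)) (Γ : Set (QEq S)) {i : T} (t : LTm S i) : TermModel Ax Γ i :=
  Quotient.mk (termSetoid Ax Γ i) t

theorem mk_eq_mk {t s : LTm S i} : mk Ax Γ t = mk Ax Γ s ↔ Entails Ax Γ ⟨∅, i, t, s, 0⟩ :=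
  ⟨fun h => Quotient.exact h, fun h => Quotient.sound h⟩

theorem mk_eq_mk_of_provEq {t s : LTm S i} (h : ProvEq Ax t s) : mk Ax Γ t = mk Ax Γ s :=
  mk_eq_mk.2 (h.entails Γ ∅)

/-- A representative of a class. -/
noncomputable def rep (a : TermModel Ax Γ i) : LTm S i := Quotient.out a

@[simp] theorem mk_rep (a : TermModel Ax Γ i) : mk Ax Γ a.rep = a := Quotient.out_eq a

theorem rep_mk (t : LTm S i) : Entails Ax Γ ⟨∅, i, (mk Ax Γ t).rep, t, 0⟩ :=
  mk_eq_mk.1 (mk_rep _)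

theorem edist_mk_le_iff {t s : LTm S i} {q : ℚ≥0} :
    edist (mk Ax Γ t) (mk Ax Γ s) ≤ ((q : ℝ≥0) : ℝ≥0∞) ↔ Entails Ax Γ ⟨∅, i, t, s, q⟩ := by
  refine (termDist_le_iff (t := (mk Ax Γ t).rep) (s := (mk Ax Γ s).rep)).trans
    ⟨fun h => ?_, fun h => ?_⟩
  · simpa using ((rep_mk t).symm'.trans' h).trans' (rep_mk s)
  · simpa using ((rep_mk t).trans' h).trans' (rep_mk s).symm'

theorem edist_le_iff {a b : TermModel Ax Γ i} {q : ℚ≥0} :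
    edist a b ≤ ((q : ℝ≥0) : ℝ≥0∞) ↔ Entails Ax Γ ⟨∅, i, a.rep, b.rep, q⟩ :=
  termDist_le_iff

theorem eq_of_edist_le_zero {a b : TermModel Ax Γ i} (h : edist a b ≤ 0) : a = b := by
  rw [← mk_rep a, ← mk_rep b, mk_eq_mk, ← edist_le_iff]
  simpa using h

/-- The operations of the term model. -/
noncomputable def op {l : List T} (σ : S.Sym l i)
    (a : ∀ k : Fin l.length, TermModel Ax Γ (l.get k)) :
    TermModel Ax Γ i :=
  mk Ax Γ (.op σ fun k => (a k).rep)

theorem op_mk {l : List T} (σ : S.Sym l i) (ts : ∀ k : Fin l.length, LTm S (l.get k)) :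
    op σ (fun k => mk Ax Γ (ts k)) = mk Ax Γ (.op σ ts) :=
  mk_eq_mk.2 (Entails.op' σ fun k => rep_mk (ts k))

theorem edist_op_le {l : List T} (σ : S.Sym l i)
    (a b : ∀ k : Fin l.length, TermModel Ax Γ (l.get k)) :
    edist (op σ a) (op σ b) ≤ ⨆ k, edist (a k) (b k) :=
  ennreal_le_of_forall_nnrat fun _ h =>
    edist_mk_le_iff.2 (Entails.op' σ fun k => edist_le_iff.1 ((le_iSup _ k).trans h))

/-- Application in the term model. -/
noncomputable def app (g : TermModel Ax Γ (S.arr i j)) (a : TermModel Ax Γ i) : TermModel Ax Γ j :=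
  op (S.appSym i j) (pair g a)

theorem pair_map {F : T → Type v} {G : T → Type w} (m : ∀ {i}, F i → G i) (a : F i) (b : F j) :
    (fun k => m (pair a b k)) = pair (m a) (m b) := by
  funext k
  obtain ⟨_ | _ | k, hk⟩ := k
  · rfl
  · rfl
  · simp at hk

theorem app_mk (t : LTm S (S.arr i j)) (s : LTm S i) :
    app (mk Ax Γ t) (mk Ax Γ s) = mk Ax Γ (t.app s) :=
  (congrArg (op (S.appSym i j))
    (pair_map (F := LTm S) (G := TermModel Ax Γ) (fun {_} t => mk Ax Γ t) t s).symm).trans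
      (op_mk (S.appSym i j) (pair t s))

theorem edist_app_le (g g' : TermModel Ax Γ (S.arr i j)) (a a' : TermModel Ax Γ i) :
    edist (app g a) (app g' a') ≤ max (edist g g') (edist a a') := by
  refine (edist_op_le _ _ _).trans (iSup_le fun k => ?_)
  obtain ⟨_ | _ | k, hk⟩ := k
  · exact le_max_left _ _
  · exact le_max_right _ _
  · simp at hk

/-- Iterated application in the term model. -/
noncomputable def appArgs : ∀ (c : List T) {j : T}, TermModel Ax Γ (arrs S c j) →
    Args (TermModel Ax Γ) c → TermModel Ax Γ j
  | [], _, g, _ => g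
  | _ :: c, _, g, a => app (appArgs c g a.1) a.2

theorem appArgs_mk (f : ∀ x : Var T, LTm S x.1) (ys : List (Var T)) :
    ∀ {j : T} (t : LTm S (arrs S (ys.map Prod.fst) j)),
    appArgs _ (mk Ax Γ t) (envArgs (fun x => mk Ax Γ (f x)) ys) = mk Ax Γ (t.appEnv f ys) := by
  induction ys with
  | nil => exact fun t => rfl
  | cons y ys ih =>
    exact fun t => (congrArg (fun g => app g (mk Ax Γ (f y))) (ih (j := S.arr y.1 _) t)).trans
      (app_mk _ _)

theorem exists_envArgs_eq {ys : List (Var T)} (hys : ys.Nodup)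
    (a : Args (TermModel Ax Γ) (ys.map Prod.fst)) :
    ∃ f : ∀ x : Var T, LTm S x.1, (∀ x ∉ ys, f x = .var x) ∧
      envArgs (fun x => mk Ax Γ (f x)) ys = a := by
  induction ys with
  | nil => exact ⟨fun x => .var x, fun _ _ => rfl, rfl⟩
  | cons y ys ih =>
    obtain ⟨hy, hys⟩ := List.nodup_cons.1 hys
    obtain ⟨f, hf, hfa⟩ := ih hys a.1
    refine ⟨Function.update f y (rep a.2), fun x hx => ?_, ?_⟩
    · rw [List.mem_cons, not_or] at hx
      rw [Function.update_of_ne hx.1, hf x hx.2]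
    · refine Prod.ext ?_ ?_
      · refine Eq.trans (envArgs_congr fun z hz => ?_) hfa
        rw [Function.update_of_ne fun h : z = y => hy (h ▸ hz)]
      · simp [envArgs]

/-- Functions of several arguments that are represented by iterated application. -/
def Rep (c : List T) (h : Args (TermModel Ax Γ) c → TermModel Ax Γ j) : Prop :=
  ∃ g : TermModel Ax Γ (arrs S c j), ∀ a, h a = appArgs c g a

/-- β-conversion in the term model: arguments can be given by representatives `f`, substituted in
any variant of the body without capture. -/
theorem appArgs_absList (H : HasLam Ax) {ys : List (Var T)} (hys : ys.Nodup) (r : LTm S j)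
    (a : Args (TermModel Ax Γ) (ys.map Prod.fst)) :
    ∃ f : ∀ x : Var T, LTm S x.1, (∀ x ∉ ys, f x = .var x) ∧
      envArgs (fun x => mk Ax Γ (f x)) ys = a ∧
      ∀ r', ProvEq Ax r r' → r'.fv = r.fv →
        (∀ x ∈ r.fv ∪ {y | y ∈ ys}, Disjoint (f x).fv r'.bd) →
        appArgs _ (mk Ax Γ (absList ys r)) a = mk Ax Γ (r'.subst f) := by
  obtain ⟨f, hf, rfl⟩ := exists_envArgs_eq hys a
  refine ⟨f, hf, rfl, fun r' h₁ h₂ h₃ => ?_⟩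
  rw [appArgs_mk, mk_eq_mk]
  exact (H.appEnv_absList_subst ys f hf r r' h₁ h₂ h₃).mono (Set.empty_subset _)

theorem rep_const (H : HasLam Ax) (c : List T) (b : TermModel Ax Γ j) : Rep c fun _ => b := by
  obtain ⟨ys, rfl, hys, hV⟩ := exists_fresh_list b.rep.finite_fv c
  refine ⟨mk Ax Γ (absList ys b.rep), fun a => ?_⟩
  obtain ⟨f, hf, -, h⟩ := appArgs_absList H hys b.rep a
  obtain ⟨r', h₁, h₂, h₃⟩ := H.exists_rename (V := ⋃ x ∈ b.rep.fv ∪ {y | y ∈ ys}, (f x).fv)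
    ((b.rep.finite_fv.union ys.finite_toSet).biUnion fun x _ => (f x).finite_fv) b.rep
  rw [h r' h₁ h₂ fun x hx =>
    (h₃.mono_right (Set.subset_biUnion_of_mem (u := fun x => (f x).fv) hx)).symm]
  rw [r'.subst_eq_self fun x hx => hf x fun hx' => hV x hx' (h₂ ▸ hx),
    ← mk_eq_mk_of_provEq h₁, mk_rep]

/-- Representable functions are closed under the operations: if `gₖ` represents the `k`-th
argument, then `λ ȳ. σ(gₖ ȳ)` represents the result, where `ȳ` is fresh for all `gₖ`. -/
theorem rep_op (H : HasLam Ax) {c l : List T} (σ : S.Sym l i)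
    {h : ∀ k : Fin l.length, Args (TermModel Ax Γ) c → TermModel Ax Γ (l.get k)}
    (hh : ∀ k, Rep c (h k)) : Rep c fun a => op σ fun k => h k a := by
  choose g hg using hh
  obtain ⟨ys, rfl, hys, hV⟩ :=
    exists_fresh_list (Set.finite_iUnion fun k => (g k).rep.finite_fv) c
  set r : LTm S i := .op σ fun k => (g k).rep.appEnv (fun x => .var x) ys with hr
  refine ⟨mk Ax Γ (absList ys r), fun a => ?_⟩
  obtain ⟨f, hf, hfa, hβ⟩ := appArgs_absList H hys r a
  have hfin : (⋃ x ∈ r.fv ∪ {y | y ∈ ys}, (f x).fv).Finite :=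
    (r.finite_fv.union ys.finite_toSet).biUnion fun x _ => (f x).finite_fv
  choose t h₁ h₂ h₃ using fun k => H.exists_rename hfin (g k).rep
  rw [hβ (.op σ fun k => (t k).appEnv (fun x => .var x) ys)
    (ProvEq.op σ fun k => (h₁ k).appEnv _ ys) ?_ ?_]
  · have h₄ : ∀ k, (t k).subst f = t k := fun k => (t k).subst_eq_self fun x hx =>
      hf x fun hx' => hV x hx' (Set.mem_iUnion.2 ⟨k, h₂ k ▸ hx⟩)
    simp only [Tm.subst, Tm.subst_appEnv_var, h₄]
    rw [← op_mk]
    congr 1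
    funext k
    rw [hg, ← appArgs_mk, hfa, ← mk_eq_mk_of_provEq (h₁ k), mk_rep]
  · simp only [hr, Tm.fv, Tm.fv_appEnv_var, h₂]
  · intro x hx
    simp only [Tm.bd, Tm.bd_appEnv_var]
    exact Set.disjoint_iUnion_right.2 fun k =>
      ((h₃ k).mono_right (Set.subset_biUnion_of_mem (u := fun x => (f x).fv) hx)).symm

theorem rep_app (H : HasLam Ax) {c : List T}
    {h : Args (TermModel Ax Γ) c → TermModel Ax Γ (S.arr i j)}
    {h' : Args (TermModel Ax Γ) c → TermModel Ax Γ i} (hh : Rep c h) (hh' : Rep c h') :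
    Rep c fun a => app (h a) (h' a) := by
  refine rep_op H (S.appSym i j) (h := fun k a => pair (h a) (h' a) k) fun k => ?_
  obtain ⟨_ | _ | k, hk⟩ := k
  · exact hh
  · exact hh'
  · simp at hk

theorem rep_snd (H : HasLam Ax) (i : T) (c : List T) :
    Rep (i :: c) fun a : Args (TermModel Ax Γ) (i :: c) => a.2 := by
  obtain ⟨ys, hc, hys, -⟩ := exists_fresh_list (Set.finite_empty (α := Var T)) (i :: c)
  obtain ⟨y, ys, rfl, rfl, rfl⟩ := List.map_eq_cons_iff.1 hc
  refine ⟨mk Ax Γ (absList (y :: ys) (.var y)), fun a => ?_⟩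
  obtain ⟨f, -, hfa, hβ⟩ := appArgs_absList H hys (.var y) a
  refine Eq.trans ?_ (hβ _ (ProvEq.refl _) rfl fun x _ => Set.disjoint_empty _).symm
  rw [← hfa]
  rfl

/-- A constant-function combinator. -/
theorem exists_app_app_eq_left (H : HasLam Ax) (i j : T) :
    ∃ k : TermModel Ax Γ (S.arr j (S.arr i j)), ∀ a b, app (app k a) b = a := by
  have hys : [((i, 1) : Var T), (j, 0)].Nodup := by simp
  refine ⟨mk Ax Γ (absList [((i, 1) : Var T), (j, 0)] (.var (j, 0))), fun a b => ?_⟩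
  obtain ⟨f, -, hfa, hβ⟩ := appArgs_absList (Ax := Ax) (Γ := Γ) H hys (.var (j, 0))
    ((PUnit.unit, a), b)
  refine (hβ _ (ProvEq.refl _) rfl fun x _ => Set.disjoint_empty _).trans ?_
  exact (Prod.ext_iff.1 (Prod.ext_iff.1 hfa).1).2

theorem rep_comp_fst (H : HasLam Ax) (i : T) {c : List T}
    {h : Args (TermModel Ax Γ) c → TermModel Ax Γ j} (hh : Rep c h) :
    Rep (i :: c) fun a : Args (TermModel Ax Γ) (i :: c) => h a.1 := by
  obtain ⟨k, hk⟩ := exists_app_app_eq_left (Γ := Γ) H i j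
  obtain ⟨g, hg⟩ := rep_app H (rep_const H c k) hh
  refine ⟨g, fun a => ?_⟩
  exact (hk (h a.1) a.2).symm.trans (congrArg (fun b => app b a.2) (hg a.1))

end TermModel

end TermModel

/-! ### Weak extensionality and the interpretation of terms -/

section Interpretation

open scoped Classical

variable {T : Type u} {S : AppSig.{u, v} T} {Ax : Set (QInf S)} {Γ : Set (QEq S)}

namespace TermModel

variable {i j : T}

/-- The combinator `λ y. λ x. y x`. Applied to `g` it gives the abstraction that represents the
function `b ↦ g · b`. -/
def one (Ax : Set (QInf S)) (Γ : Set (QEq S)) (i j : T) :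
    TermModel Ax Γ (S.arr (S.arr i j) (S.arr i j)) :=
  mk Ax Γ (.lam (S.arr i j, 0) (.lam (i, 1)
    (Tm.app (.var (S.arr i j, 0) : LTm S (S.arr i j)) (.var (i, 1) : LTm S i))))

theorem app_one_app (H : HasLam Ax) (g : TermModel Ax Γ (S.arr i j)) (b : TermModel Ax Γ i) :
    app (app (one Ax Γ i j) g) b = app g b := by
  have hys : [((i, 1) : Var T), (S.arr i j, 0)].Nodup := by simp
  obtain ⟨f, -, hfa, hβ⟩ := appArgs_absList (Ax := Ax) (Γ := Γ) H hys
    (Tm.app (.var (S.arr i j, 0) : LTm S (S.arr i j)) (.var (i, 1) : LTm S i))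
    ((PUnit.unit, g), b)
  have h := hβ _ (ProvEq.refl _) rfl fun x _ => by
    simp [Tm.bd_app, Tm.bd]
  have hg : mk Ax Γ (f (S.arr i j, 0)) = g := (Prod.ext_iff.1 (Prod.ext_iff.1 hfa).1).2
  have hb : mk Ax Γ (f (i, 1)) = b := (Prod.ext_iff.1 hfa).2
  refine h.trans ?_
  rw [Tm.subst_app, ← app_mk]
  exact congrArg₂ app hg hb

/-- The bound variable of `one` may be renamed to any `(i, m)` not free in `t`; `2 ≤ m` keeps it
distinct from the two variables in the definition of `one`. -/
theorem app_one_mk (H : HasLam Ax) (t : LTm S (S.arr i j)) (m : ℕ) (hm : 2 ≤ m)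
    (hmt : ((i, m) : Var T) ∉ t.fv) :
    app (one Ax Γ i j) (mk Ax Γ t) = mk Ax Γ (.lam (i, m) (t.app (.var (i, m)))) := by
  set y : Var T := (S.arr i j, 0) with hy
  set b : LTm S j := Tm.app (.var y : LTm S (S.arr i j)) (.var (i, 1) : LTm S i) with hb
  have hfv : b.fv = {y, (i, 1)} := Tm.fv_app _ _
  have hbd : b.bd = ∅ := (Tm.bd_app _ _).trans (Set.union_empty _)
  have hmy : ((i, m) : Var T) ≠ y := fun h => by
    have := (Prod.ext_iff.1 h).2
    simp only [hy] at this
    omega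
  have hm1 : ((i, m) : Var T) ≠ (i, 1) := fun h => by
    have := (Prod.ext_iff.1 h).2
    simp only at this
    omega
  have hmf : ((i, m) : Var T) ∉ b.fv := by simp [hfv, hmy, hm1]
  have hmb : ((i, m) : Var T) ∉ b.bd := by simp [hbd]
  have hy1 : y ≠ (i, 1) := fun h => by
    have := (Prod.ext_iff.1 h).2
    simp [hy] at this
  rw [one, app_mk, mk_eq_mk]
  have h := H.appEnv_absList_subst [y] (Function.update (fun x => .var x) y t)
    (fun x hx => Function.update_of_ne (fun h => hx (by simp [h])) _ _)
    (.lam (i, 1) b) (.lam (i, m) (b.subst1 (i, 1) (.var (i, m))))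
    (H.alpha i 1 m b hmf hmb) (b.fv_lam_subst1_var i 1 m hmf hmb) (by
      intro x hx
      have hbd' : (Tm.lam (i, m) (b.subst1 (i, 1) (.var (i, m)))).bd = {(i, m)} := by
        rw [Tm.bd, b.bd_subst1_var i 1 m, hbd]
        simp
      have hxy : x = y := by
        rcases hx with hx | hx
        · simp only [Tm.fv, hfv] at hx
          rcases hx with ⟨hx | hx, hx'⟩
          · exact hx
          · exact (hx' hx).elim
        · simpa using hx
      subst hxy
      rw [hbd', Function.update_self]
      exact Set.disjoint_singleton_right.2 hmt)
  have h' : (Tm.lam (i, m) (b.subst1 (i, 1) (.var (i, m)))).subst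
      (Function.update (fun x => .var x) y t) = .lam (i, m) (t.app (.var (i, m))) := by
    simp only [hb, Tm.subst1, Tm.subst_app, Tm.subst]
    rw [Function.update_of_ne hy1, Function.update_self]
    simp only [Tm.subst, Function.update_self]
    rw [Function.update_of_ne hmy.symm, Function.update_self]
  rw [h', Tm.appEnv, Function.update_self] at h
  exact h.mono (Set.empty_subset _)

/-- A variable that can be abstracted: fresh for the hypotheses and for a given finite set, and
distinct from the bound variables of `one`. -/
theorem exists_fresh_two_le (hΓ : (⋃ e ∈ Γ, e.fv).Finite) {V : Set (Var T)} (hV : V.Finite)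
    (i : T) : ∃ m : ℕ, 2 ≤ m ∧ ((i, m) : Var T) ∉ V ∧ ∀ e ∈ Γ, ((i, m) : Var T) ∉ e.fv := by
  have hf : ({((i, 0) : Var T), (i, 1)} ∪ (V ∪ ⋃ e ∈ Γ, e.fv)).Finite :=
    (Set.toFinite _).union (hV.union hΓ)
  obtain ⟨m, hm⟩ := exists_fresh hf i
  simp only [Set.mem_union, Set.mem_insert_iff, Set.mem_singleton_iff, Set.mem_iUnion, not_or,
    not_exists, Prod.mk.injEq, true_and] at hm
  exact ⟨m, by omega, hm.2.1, hm.2.2⟩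

/-- Weak extensionality: abstraction does not increase the uniform distance of functions. It
suffices to compare the functions at one fresh variable. -/
theorem edist_app_one_le (H : HasLam Ax) (hΓ : (⋃ e ∈ Γ, e.fv).Finite)
    {g g' : TermModel Ax Γ (S.arr i j)} {r : ℝ≥0∞}
    (h : ∀ b, edist (app g b) (app g' b) ≤ r) :
    edist (app (one Ax Γ i j) g) (app (one Ax Γ i j) g') ≤ r := by
  obtain ⟨m, hm, hmV, hmΓ⟩ := exists_fresh_two_le hΓ (g.rep.finite_fv.union g'.rep.finite_fv) i
  rw [Set.mem_union, not_or] at hmV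
  refine ennreal_le_of_forall_nnrat fun q hq => ?_
  have hz := (h (mk Ax Γ (.var (i, m)))).trans hq
  rw [← mk_rep g, ← mk_rep g', app_mk, app_mk, edist_mk_le_iff] at hz
  rw [← mk_rep g, ← mk_rep g', app_one_mk H _ m hm hmV.1, app_one_mk H _ m hm hmV.2,
    edist_mk_le_iff]
  exact H.generalize hΓ (i, m) hmΓ hz

theorem app_one_congr (H : HasLam Ax) (hΓ : (⋃ e ∈ Γ, e.fv).Finite)
    {g g' : TermModel Ax Γ (S.arr i j)} (h : ∀ b, app g b = app g' b) :
    app (one Ax Γ i j) g = app (one Ax Γ i j) g' :=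
  eq_of_edist_le_zero (edist_app_one_le H hΓ fun b => by rw [h b, edist_self])

/-- The abstraction of a function represented by some `g`; an arbitrary element if the function
is not representable. -/
noncomputable def lamOf (k : TermModel Ax Γ i → TermModel Ax Γ j) : TermModel Ax Γ (S.arr i j) :=
  if h : ∃ g, ∀ b, k b = app g b then app (one Ax Γ i j) h.choose
  else mk Ax Γ (.var (S.arr i j, 0))

theorem lamOf_eq (H : HasLam Ax) (hΓ : (⋃ e ∈ Γ, e.fv).Finite)
    {k : TermModel Ax Γ i → TermModel Ax Γ j} {g : TermModel Ax Γ (S.arr i j)}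
    (h : ∀ b, k b = app g b) : lamOf k = app (one Ax Γ i j) g := by
  have hk : ∃ g, ∀ b, k b = app g b := ⟨g, h⟩
  rw [lamOf, dif_pos hk]
  exact app_one_congr H hΓ fun b => by rw [← hk.choose_spec, h]

/-- The interpretation of terms with constants from the term model, by recursion on terms; an
abstraction is interpreted by the function that it defines. -/
noncomputable def interp (ρ : ∀ x : Var T, TermModel Ax Γ x.1) {i : T} :
    Tm S (TermModel Ax Γ) i → TermModel Ax Γ i
  | .var x => ρ x
  | .par a => a
  | .op σ ts => op σ fun k => interp ρ (ts k)
  | .lam x t => lamOf fun b => interp (Function.update ρ x b) t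

/-- Functional completeness: the interpretation is representable as a function of the arguments on
which an assignment depends representably. -/
theorem rep_interp (H : HasLam Ax) (hΓ : (⋃ e ∈ Γ, e.fv).Finite)
    (t : Tm S (TermModel Ax Γ) i) : ∀ (c : List T)
    (E : Args (TermModel Ax Γ) c → ∀ x : Var T, TermModel Ax Γ x.1),
    (∀ x, Rep c fun a => E a x) → Rep c fun a => interp (E a) t := by
  induction t with
  | var x => exact fun c E hE => hE x
  | par b => exact fun c E _ => rep_const H c b
  | op σ ts ih => exact fun c E hE => rep_op H σ fun k => ih k c E hE
  | @lam j x t ih =>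
    intro c E hE
    have hE' : ∀ y, Rep (x.1 :: c) fun a : Args (TermModel Ax Γ) (x.1 :: c) =>
        Function.update (E a.1) x a.2 y := by
      intro y
      by_cases hyx : y = x
      · subst hyx
        simp only [Function.update_self]
        exact rep_snd H y.1 c
      · simp only [Function.update_of_ne hyx]
        exact rep_comp_fst H x.1 (hE y)
    obtain ⟨g, hg⟩ := ih (x.1 :: c) (fun a => Function.update (E a.1) x a.2) hE'
    have h₁ : ∀ a, interp (E a) (.lam x t) = app (one Ax Γ x.1 j) (appArgs c g a) := fun a =>
      lamOf_eq H hΓ fun b => hg (a, b)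
    obtain ⟨g', hg'⟩ := rep_app H (rep_const H c (one Ax Γ x.1 j))
      (h' := fun a => appArgs c g a) ⟨g, fun _ => rfl⟩
    exact ⟨g', fun a => (h₁ a).trans (hg' a)⟩

theorem exists_interp_eq_app (H : HasLam Ax) (hΓ : (⋃ e ∈ Γ, e.fv).Finite)
    (ρ : ∀ x : Var T, TermModel Ax Γ x.1) (x : Var T) (t : Tm S (TermModel Ax Γ) j) :
    ∃ g : TermModel Ax Γ (S.arr x.1 j), ∀ b, interp (Function.update ρ x b) t = app g b := by
  obtain ⟨g, hg⟩ := rep_interp H hΓ t [x.1] (fun a => Function.update ρ x a.2) fun y => by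
    by_cases hyx : y = x
    · subst hyx
      simp only [Function.update_self]
      exact rep_snd H y.1 []
    · simp only [Function.update_of_ne hyx]
      exact rep_const H _ _
  exact ⟨g, fun b => hg (PUnit.unit, b)⟩

theorem app_interp_lam (H : HasLam Ax) (hΓ : (⋃ e ∈ Γ, e.fv).Finite)
    (ρ : ∀ x : Var T, TermModel Ax Γ x.1) (x : Var T) (t : Tm S (TermModel Ax Γ) j)
    (b : TermModel Ax Γ x.1) :
    app (interp ρ (.lam x t)) b = interp (Function.update ρ x b) t := by
  obtain ⟨g, hg⟩ := exists_interp_eq_app H hΓ ρ x t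
  rw [interp, lamOf_eq H hΓ hg, app_one_app H, hg]

theorem edist_interp_lam_le (H : HasLam Ax) (hΓ : (⋃ e ∈ Γ, e.fv).Finite)
    {ρ : ∀ x : Var T, TermModel Ax Γ x.1} {x : Var T} {t s : Tm S (TermModel Ax Γ) j} {r : ℝ≥0∞}
    (h : ∀ b, edist (interp (Function.update ρ x b) t) (interp (Function.update ρ x b) s) ≤ r) :
    edist (interp ρ (.lam x t)) (interp ρ (.lam x s)) ≤ r := by
  obtain ⟨g, hg⟩ := exists_interp_eq_app H hΓ ρ x t
  obtain ⟨g', hg'⟩ := exists_interp_eq_app H hΓ ρ x s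
  rw [interp, interp, lamOf_eq H hΓ hg, lamOf_eq H hΓ hg']
  exact edist_app_one_le H hΓ fun b => by rw [← hg, ← hg']; exact h b

theorem app_one_interp_lam (H : HasLam Ax) (hΓ : (⋃ e ∈ Γ, e.fv).Finite)
    (ρ : ∀ x : Var T, TermModel Ax Γ x.1) (x : Var T) (t : Tm S (TermModel Ax Γ) j) :
    app (one Ax Γ x.1 j) (interp ρ (.lam x t)) = interp ρ (.lam x t) := by
  obtain ⟨g, hg⟩ := exists_interp_eq_app H hΓ ρ x t
  rw [interp, lamOf_eq H hΓ hg]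
  exact app_one_congr H hΓ (app_one_app H g)

theorem interp_congr (t : Tm S (TermModel Ax Γ) i) :
    ∀ {ρ ρ' : ∀ x : Var T, TermModel Ax Γ x.1}, (∀ x ∈ t.fv, ρ x = ρ' x) →
    interp ρ t = interp ρ' t := by
  induction t with
  | var x => exact fun h => h x rfl
  | par b => exact fun _ => rfl
  | op σ ts ih =>
    intro ρ ρ' h
    simp only [interp]
    congr 1
    funext k
    exact ih k fun x hx => h x (Set.mem_iUnion.2 ⟨k, hx⟩)
  | lam x t ih =>
    intro ρ ρ' h
    simp only [interp]
    congr 1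
    funext b
    refine ih fun y hy => ?_
    by_cases hyx : y = x
    · subst hyx; simp
    · simp only [Function.update_of_ne hyx]
      exact h y ⟨hy, hyx⟩

/-- The assignment that agrees with `ρ'` on the list `ys` and with `ρ` elsewhere. -/
noncomputable def overrideList {A : T → Type w} (ρ ρ' : ∀ x : Var T, A x.1) (ys : List (Var T)) :
    ∀ x : Var T, A x.1 :=
  fun x => if x ∈ ys then ρ' x else ρ x

theorem update_overrideList {A : T → Type w} (ρ ρ' : ∀ x : Var T, A x.1) (y : Var T)
    (ys : List (Var T)) (b : A y.1) :
    Function.update (overrideList ρ ρ' ys) y b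
      = overrideList ρ (Function.update ρ' y b) (y :: ys) := by
  funext x
  by_cases hxy : x = y
  · subst hxy; simp [overrideList]
  · simp [overrideList, hxy]

theorem appArgs_interp_absList (H : HasLam Ax) (hΓ : (⋃ e ∈ Γ, e.fv).Finite)
    (ρ ρ' : ∀ x : Var T, TermModel Ax Γ x.1) (ys : List (Var T)) :
    ∀ {j : T} (t : Tm S (TermModel Ax Γ) j),
    appArgs _ (interp ρ (absList ys t)) (envArgs ρ' ys) = interp (overrideList ρ ρ' ys) t := by
  induction ys with
  | nil =>
    intro j t
    refine interp_congr t fun x _ => ?_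
    simp [overrideList]
  | cons y ys ih =>
    intro j t
    refine (congrArg (fun g => app g (ρ' y)) (ih (.lam y t))).trans ?_
    rw [app_interp_lam H hΓ, update_overrideList, Function.update_eq_self]

theorem edist_interp_absList_le (H : HasLam Ax) (hΓ : (⋃ e ∈ Γ, e.fv).Finite)
    (ρ : ∀ x : Var T, TermModel Ax Γ x.1) {r : ℝ≥0∞} (ys : List (Var T)) :
    ∀ {j : T} {t s : Tm S (TermModel Ax Γ) j},
    (∀ ρ', edist (interp (overrideList ρ ρ' ys) t) (interp (overrideList ρ ρ' ys) s) ≤ r) →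
    edist (interp ρ (absList ys t)) (interp ρ (absList ys s)) ≤ r := by
  induction ys with
  | nil =>
    intro j t s h
    have h' := h ρ
    have : overrideList ρ ρ [] = ρ := by funext x; simp [overrideList]
    rwa [this] at h'
  | cons y ys ih =>
    intro j t s h
    refine ih fun ρ' => edist_interp_lam_le H hΓ fun b => ?_
    rw [update_overrideList]
    exact h _

/-- If `ρ` assigns to each variable `x` the class of `f x`, then the interpretation of `t` is the
class of `t'[f]`, for a variant `t'` of `t` in which the variables of `V` are not bound. -/
theorem exists_interp_eq_mk_subst (H : HasLam Ax) (hΓ : (⋃ e ∈ Γ, e.fv).Finite) (t : LTm S i) :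
    ∀ {V : Set (Var T)} (_ : V.Finite) (f : ∀ x : Var T, LTm S x.1), ∃ t', ProvEq Ax t t' ∧
      t'.fv = t.fv ∧ Disjoint t'.bd V ∧
      interp (fun x => mk Ax Γ (f x)) (t.embed (TermModel Ax Γ)) = mk Ax Γ (t'.subst f) := by
  induction t with
  | var x => exact fun _ f => ⟨_, ProvEq.refl _, rfl, Set.empty_disjoint _, rfl⟩
  | par a => exact a.elim
  | op σ ts ih =>
    intro V hV f
    choose t' h₁ h₂ h₃ h₄ using fun k => ih k hV f
    refine ⟨.op σ t', ProvEq.op σ h₁, Set.iUnion_congr h₂, Set.disjoint_iUnion_left.2 h₃, ?_⟩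
    simp only [Tm.embed, interp, h₄, Tm.subst]
    exact op_mk σ _
  | @lam j x t ih =>
    intro V hV f
    obtain ⟨g, hg⟩ := exists_interp_eq_app H hΓ (fun x => mk Ax Γ (f x)) x
      (t.embed (TermModel Ax Γ))
    obtain ⟨m, hm, hmV, hmΓ⟩ :=
      exists_fresh_two_le hΓ ((g.rep.finite_fv.union t.finite_fv).union hV) x.1
    rw [Set.mem_union, Set.mem_union, not_or, not_or] at hmV
    obtain ⟨⟨hmg, hmt⟩, hmV⟩ := hmV
    obtain ⟨t', h₁, h₂, h₃, h₄⟩ :=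
      ih (hV.insert (x.1, m)) (Function.update f x (.var (x.1, m)))
    have hmb : ((x.1, m) : Var T) ∉ t'.bd := fun h =>
      Set.disjoint_left.1 h₃ h (Set.mem_insert _ _)
    rw [← h₂] at hmt
    refine ⟨.lam (x.1, m) (t'.subst1 x (.var (x.1, m))),
      (H.lam h₁).trans (H.alpha x.1 x.2 m t' hmt hmb),
      (t'.fv_lam_subst1_var x.1 x.2 m hmt hmb).trans (by simp only [Tm.fv, h₂]), ?_, ?_⟩
    · refine Set.disjoint_insert_left.2 ⟨hmV, ?_⟩
      rw [Tm.bd_subst1_var t' x.1 x.2 m]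
      exact h₃.mono_right (Set.subset_insert _ _)
    · -- Compare `g` with the body at the fresh variable `z = (x.1, m)`: both `λ z. g z` and the
      -- renamed abstraction are then abstractions of provably equal terms.
      have hgz := hg (mk Ax Γ (.var (x.1, m)))
      have hupd : Function.update (fun x => mk Ax Γ (f x)) x (mk Ax Γ (.var (x.1, m)))
          = fun y => mk Ax Γ (Function.update f x (.var (x.1, m)) y) := by
        funext y
        by_cases hyx : y = x
        · subst hyx; simp
        · simp [Function.update_of_ne hyx]
      rw [hupd, h₄, ← mk_rep g, app_mk, mk_eq_mk] at hgz
      simp only [Tm.embed, interp, Tm.subst]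
      rw [lamOf_eq H hΓ hg, ← mk_rep g, app_one_mk H _ m hm hmg, mk_eq_mk,
        t'.subst1_var_subst x.1 x.2 m hmt hmb f (.var (x.1, m))]
      exact H.generalize hΓ (x.1, m) hmΓ hgz.symm'

end TermModel

end Interpretation

/-! ### The term model as a quantitative `λ`-algebra -/

section TermAlgebra

open scoped Classical

variable {T : Type u} {S : AppSig.{u, v} T} {Ax : Set (QInf S)} {Γ : Set (QEq S)}

namespace TermModel

variable {i j : T}

theorem exists_appArgs_eq_app_one (H : HasLam Ax) (c : List T) (i j : T)
    (g : TermModel Ax Γ (arrs S c (S.arr i j))) :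
    ∃ g' : TermModel Ax Γ (arrs S c (S.arr i j)), ∀ a,
      app (one Ax Γ i j) (appArgs c g a) = appArgs c g' a :=
  rep_app H (rep_const H c (one Ax Γ i j)) (h' := fun a => appArgs c g a) ⟨g, fun _ => rfl⟩

/-- The element assigned to a closed term `t` of sort `w → j`. If `w = w' * i` is not empty, it is
an element `g'` such that `g' · a⃗` is the abstraction of `b ↦ t · a⃗ · b`, for all `a⃗` of sorts
`w'`. Hence `a⃗ ↦ g' · a⃗` depends only on the function that `t` represents. -/
noncomputable def closing (H : HasLam Ax) : ∀ (c : List T) (j : T),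
    {t : Tm S (TermModel Ax Γ) (arrs S c j) // t.fv = ∅} → TermModel Ax Γ (arrs S c j)
  | [], _, t => interp (fun x => mk Ax Γ (.var x)) t.1
  | i :: c, j, t =>
    (exists_appArgs_eq_app_one H c i j (interp (fun x => mk Ax Γ (.var x)) t.1)).choose

theorem appArgs_closing_cons (H : HasLam Ax) (c : List T) (i j : T)
    (t : {t : Tm S (TermModel Ax Γ) (arrs S (i :: c) j) // t.fv = ∅})
    (a : Args (TermModel Ax Γ) c) :
    appArgs (j := S.arr i j) c (closing H (i :: c) j t) a = app (one Ax Γ i j)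
      (appArgs (j := S.arr i j) c (interp (fun x => mk Ax Γ (.var x)) t.1) a) :=
  ((exists_appArgs_eq_app_one H c i j
    (interp (fun x => mk Ax Γ (.var x)) t.1)).choose_spec a).symm

theorem appArgs_closing (H : HasLam Ax) (c : List T) (j : T)
    (t : {t : Tm S (TermModel Ax Γ) (arrs S c j) // t.fv = ∅}) (a : Args (TermModel Ax Γ) c) :
    appArgs c (closing H c j t) a = appArgs c (interp (fun x => mk Ax Γ (.var x)) t.1) a := by
  cases c with
  | nil => rfl
  | cons i c =>
    exact (congrArg (fun g => app g a.2) (appArgs_closing_cons H c i j t a.1)).trans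
      (app_one_app H _ _)

end TermModel

open TermModel

/-- The term model as an applicative `λ`-algebra. -/
noncomputable def termAlg (H : HasLam Ax) (Γ : Set (QEq S)) : AppAlg.{u, v, max u v} S where
  carrier := TermModel Ax Γ
  metric := inferInstance
  op := TermModel.op
  op_nonexp := edist_op_le
  closing := TermModel.closing H

theorem termAlg_appArgs (H : HasLam Ax) (c : List T) : ∀ {j : T}
    (g : TermModel Ax Γ (arrs S c j)) (a : Args (TermModel Ax Γ) c),
    (termAlg H Γ).appArgs c g a = TermModel.appArgs c g a := by
  induction c with
  | nil => exact fun g a => rfl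
  | cons i c ih =>
    exact fun {j} g a => congrArg (fun g => TermModel.app g a.2) (ih (j := S.arr i j) g a.1)

theorem termAlg_repr (H : HasLam Ax) (c : List T) (j : T)
    (t : {t : Tm S (TermModel Ax Γ) (arrs S c j) // t.fv = ∅}) (a : Args (TermModel Ax Γ) c) :
    (termAlg H Γ).repr c j t a
      = TermModel.appArgs c (interp (fun x => mk Ax Γ (.var x)) t.1) a :=
  (termAlg_appArgs H c _ a).trans (appArgs_closing H c j t a)

theorem edist_appArgs_le (H : HasLam Ax) (c : List T) : ∀ {j : T}
    (g g' : TermModel Ax Γ (arrs S c j)) (a b : Args (TermModel Ax Γ) c),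
    edist (TermModel.appArgs c g a) (TermModel.appArgs c g' b)
      ≤ max (edist g g') ((termAlg H Γ).argDist c a b) := by
  induction c with
  | nil => exact fun g g' a b => le_max_left _ _
  | cons i c ih =>
    intro j g g' a b
    refine (edist_app_le _ _ _ _).trans ?_
    refine (max_le_max_right _ (ih (j := S.arr i j) g g' a.1 b.1)).trans ?_
    exact (max_assoc _ _ _).le

/-- The representable functions are automatically non-expansive, and every element `g` of the model
is the interpretation of a closed term, namely of `g` as a constant. -/
theorem mem_termAlg_Met (H : HasLam Ax) {c : List T} {j : T}
    {h : Args (TermModel Ax Γ) c → TermModel Ax Γ j} : h ∈ (termAlg H Γ).Met c j ↔ Rep c h := by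
  constructor
  · rintro ⟨-, t, rfl⟩
    exact ⟨_, termAlg_repr H c j t⟩
  · rintro ⟨g, hg⟩
    obtain rfl : h = TermModel.appArgs c g := funext hg
    exact ⟨fun a b => (edist_appArgs_le H c g g a b).trans
      (max_le ((edist_self g).le.trans bot_le) le_rfl),
      ⟨.par g, rfl⟩, funext fun a => (termAlg_repr H c j ⟨.par g, rfl⟩ a).symm⟩

theorem rep_comp (H : HasLam Ax) {c c' : List T} {j : T}
    {h : Args (TermModel Ax Γ) c → TermModel Ax Γ j}
    {g : Args (TermModel Ax Γ) c' → Args (TermModel Ax Γ) c} (hh : Rep c h)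
    (hg : (termAlg H Γ).MetTuple c' c g) : Rep c' fun a => h (g a) := by
  obtain ⟨q, hq⟩ := hh
  obtain rfl : h = TermModel.appArgs c q := funext hq
  clear hq
  induction c generalizing j with
  | nil => exact rep_const H c' q
  | cons i c ih =>
    exact rep_app H (ih (j := S.arr i j) (g := fun a => (g a).1) hg.1 _)
      ((mem_termAlg_Met H).1 hg.2)

theorem metTuple_comp_fst (H : HasLam Ax) (i : T) {c c' : List T}
    {g : Args (TermModel Ax Γ) c' → Args (TermModel Ax Γ) c}
    (hg : (termAlg H Γ).MetTuple c' c g) :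
    (termAlg H Γ).MetTuple (i :: c') c fun a => g a.1 := by
  induction c with
  | nil => trivial
  | cons k c ih =>
    exact ⟨ih (g := fun a => (g a).1) hg.1,
      (mem_termAlg_Met H).2 (rep_comp_fst H i ((mem_termAlg_Met H).1 hg.2))⟩

theorem metTuple_id (H : HasLam Ax) (c : List T) : (termAlg H Γ).MetTuple c c id := by
  induction c with
  | nil => trivial
  | cons i c ih => exact ⟨metTuple_comp_fst H i ih, (mem_termAlg_Met H).2 (rep_snd H i c)⟩

theorem lamOf_eq_of_rep (H : HasLam Ax) (hΓ : (⋃ e ∈ Γ, e.fv).Finite) {c : List T} {i j : T}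
    {h : Args (TermModel Ax Γ) (i :: c) → TermModel Ax Γ j}
    {g : TermModel Ax Γ (arrs S c (S.arr i j))}
    (hg : ∀ a, h a = TermModel.appArgs (i :: c) g a) (a : Args (TermModel Ax Γ) c) :
    (lamOf fun b => h (a, b)) = TermModel.app (one Ax Γ i j) (TermModel.appArgs c g a) :=
  lamOf_eq H hΓ fun b => hg (a, b)

/-- Abstraction of the last argument, at each value of the other arguments. -/
noncomputable def termLam (Ax : Set (QInf S)) (Γ : Set (QEq S)) (c : List T) (i j : T)
    (h : Args (TermModel Ax Γ) (i :: c) → TermModel Ax Γ j) (a : Args (TermModel Ax Γ) c) :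
    TermModel Ax Γ (S.arr i j) :=
  lamOf fun b => h (a, b)

theorem termAlg_isRetraction (H : HasLam Ax) (hΓ : (⋃ e ∈ Γ, e.fv).Finite) :
    (termAlg H Γ).IsRetraction (termLam Ax Γ) where
  id_mem := metTuple_id H
  comp_mem c c' j f g hf hg := by
    have h := (mem_termAlg_Met H).1 hf
    exact (mem_termAlg_Met H).2 (rep_comp (c := c) (h := f) H h hg)
  lam_eq c i j t := by
    funext a
    refine (lamOf_eq_of_rep H hΓ (termAlg_repr H (i :: c) j t) a).trans ?_
    exact ((termAlg_appArgs H c (j := S.arr i j) _ a).trans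
      (appArgs_closing_cons H c i j t a)).symm
  lam_mem c i j h hh := by
    obtain ⟨g, hg⟩ := (mem_termAlg_Met H).1 hh
    obtain ⟨g', hg'⟩ := exists_appArgs_eq_app_one H c i j g
    exact (mem_termAlg_Met H).2
      ⟨g', fun a => (lamOf_eq_of_rep H hΓ hg a).trans (hg' a)⟩
  ev_mem c i j f hf := by
    obtain ⟨g, hg⟩ := (mem_termAlg_Met H).1 hf
    exact (mem_termAlg_Met H).2
      ⟨g, fun a => congrArg (fun g => TermModel.app g a.2) (hg a.1)⟩
  ev_lam c i j h hh := by
    obtain ⟨g, hg⟩ := (mem_termAlg_Met H).1 hh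
    funext a
    refine (congrArg (fun g => TermModel.app g a.2) (lamOf_eq_of_rep H hΓ hg a.1)).trans ?_
    exact (app_one_app H _ _).trans (hg a).symm
  lam_natural _ _ _ _ _ _ _ _ := rfl
  ev_natural _ _ _ _ _ _ _ _ := rfl
  lam_nonexp c i j h hh h' hh' := by
    obtain ⟨g, hg⟩ := (mem_termAlg_Met H).1 hh
    obtain ⟨g', hg'⟩ := (mem_termAlg_Met H).1 hh'
    refine sInf_le_sInf fun δ hδ a a' => ?_
    refine (congrArg₂ edist (lamOf_eq_of_rep H hΓ hg a) (lamOf_eq_of_rep H hΓ hg' a')).le.trans ?_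
    refine edist_app_one_le H hΓ fun b => ?_
    refine (congrArg₂ edist (hg (a, b)) (hg' (a', b))).ge.trans ?_
    refine (hδ (a, b) (a', b)).trans (max_le_max_left δ (max_le le_rfl ?_))
    exact (edist_self b).le.trans bot_le
  ev_nonexp c i j f _ f' _ := by
    refine sInf_le_sInf fun δ hδ a a' => ?_
    refine (edist_app_le _ _ _ _).trans ?_
    exact (max_le_max_right _ (hδ a.1 a'.1)).trans (max_assoc _ _ _).le

/-- If (η) is derivable, then `one` acts as the identity. -/
theorem termAlg_isExt (H : HasLam Ax) (hΓ : (⋃ e ∈ Γ, e.fv).Finite)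
    (hη : ∀ p, EtaAx p → Entails Ax ↑p.1 p.2) (c : List T) (i j : T)
    (f : Args (TermModel Ax Γ) c → TermModel Ax Γ (S.arr i j))
    (_ : f ∈ (termAlg H Γ).Met c (S.arr i j)) :
    termLam Ax Γ c i j ((termAlg H Γ).ev c i j f) = f := by
  funext a
  refine (lamOf_eq H hΓ (g := f a) fun b => rfl).trans ?_
  obtain ⟨m, hm, hmV, -⟩ := exists_fresh_two_le hΓ (f a).rep.finite_fv i
  conv_lhs => rw [← mk_rep (f a)]
  conv_rhs => rw [← mk_rep (f a)]
  rw [app_one_mk H _ m hm hmV, mk_eq_mk]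
  exact ((hη _ (EtaAx.eta ∅ (i, m) (f a).rep hmV)).mono (by simp)).symm'

/-- The evaluation of `λ`-terms in the algebra, which applies the closure of an abstraction to the
values of its free variables, is the recursive interpretation. -/
theorem termAlg_eval (H : HasLam Ax) (hΓ : (⋃ e ∈ Γ, e.fv).Finite)
    (ρ : ∀ x : Var T, TermModel Ax Γ x.1) {i : T} (t : LTm S i) :
    (termAlg H Γ).eval ρ t = interp ρ (t.embed (TermModel Ax Γ)) := by
  induction t with
  | var x => rfl
  | par a => exact a.elim
  | op σ ts ih => exact congrArg (TermModel.op σ) (funext ih)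
  | @lam j x t _ =>
    refine (termAlg_appArgs H _ (j := S.arr x.1 j) _ _).trans ?_
    refine (appArgs_closing_cons H _ x.1 j _ _).trans ?_
    refine (congrArg (TermModel.app _) (appArgs_interp_absList H hΓ _ ρ (Tm.lam x t).fvList
      (Tm.lam x (t.embed (TermModel Ax Γ))))).trans ?_
    rw [app_one_interp_lam H hΓ]
    refine interp_congr _ fun y hy => if_pos ?_
    rw [Tm.mem_fvList]
    simpa only [Tm.fv, Tm.fv_embed] using hy

theorem embed_absList (P : T → Type w) (ys : List (Var T)) : ∀ {j : T} (t : LTm S j),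
    (absList ys t).embed P = absList ys (t.embed P) := by
  induction ys with
  | nil => exact fun t => rfl
  | cons y ys ih => exact fun t => ih (Tm.lam y t)

theorem argDist_envArgs_le (H : HasLam Ax) (X : Finset (Var T)) (ys : List (Var T))
    (hys : ∀ y ∈ ys, y ∈ X) (a b : ∀ x : Var T, TermModel Ax Γ x.1) :
    (termAlg H Γ).argDist _ (envArgs a ys) (envArgs b ys) ≤ ⨆ x ∈ X, edist (a x) (b x) := by
  induction ys with
  | nil => exact bot_le
  | cons y ys ih =>
    refine max_le (ih fun z hz => hys z (List.mem_cons_of_mem _ hz)) ?_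
    exact le_iSup₂ (f := fun x (_ : x ∈ X) => edist (a x) (b x)) y (hys y List.mem_cons_self)

/-- Validity of an equation in the term model is a bound on the distance of two closures. -/
theorem termAlg_holdsAt_iff (H : HasLam Ax) (hΓ : (⋃ e ∈ Γ, e.fv).Finite)
    (ρ : ∀ x : Var T, TermModel Ax Γ x.1) (e : QEq S) :
    (termAlg H Γ).HoldsAt ρ e ↔
      edist (interp ρ (e.closed.lhs.embed (TermModel Ax Γ)))
        (interp ρ (e.closed.rhs.embed (TermModel Ax Γ))) ≤ ((e.ε : ℝ≥0) : ℝ≥0∞) := by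
  have hov : ∀ a, (termAlg H Γ).override e.X ρ a = overrideList ρ a e.X.toList := by
    intro a
    funext x
    by_cases hx : x ∈ e.X
    · simp [AppAlg.override, overrideList, hx]
    · simp only [AppAlg.override, overrideList, hx, Finset.mem_toList]
      rfl
  simp only [AppAlg.HoldsAt, hov, termAlg_eval H hΓ, QEq.closed, embed_absList]
  constructor
  · intro h
    refine edist_interp_absList_le H hΓ ρ _ fun a => (h a a).trans (max_le ?_ le_rfl)
    exact iSup₂_le fun x _ => (edist_self (a x)).le.trans bot_le
  · intro h a b
    refine (congrArg₂ edist (appArgs_interp_absList H hΓ ρ a _ _)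
      (appArgs_interp_absList H hΓ ρ b _ _)).ge.trans ?_
    refine (edist_appArgs_le H _ _ _ _ _).trans (max_le (h.trans (le_max_right _ _)) ?_)
    exact (argDist_envArgs_le H e.X _ (fun y hy => Finset.mem_toList.1 hy) a b).trans
      (le_max_left _ _)

/-- Validity of an equation in the term model, at the assignment of the terms `f x`, is
derivability of the substitution instance by `f` of a suitable equivalent equation. -/
theorem exists_termAlg_holdsAt_iff_entails (H : HasLam Ax) (hΓ : (⋃ e ∈ Γ, e.fv).Finite)
    (f : ∀ x : Var T, LTm S x.1) {V : Set (Var T)} (hV : V.Finite) (e : QEq S) :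
    ∃ e' : QEq S, e'.X = ∅ ∧ e'.fv = e.fv ∧ Disjoint e'.bd V ∧
      (∀ Δ, Entails Ax Δ e' ↔ Entails Ax Δ e) ∧
      ((termAlg H Γ).HoldsAt (fun x => mk Ax Γ (f x)) e ↔ Entails Ax Γ (e'.subst f)) := by
  obtain ⟨l, hl, hlf, hlb, hli⟩ := exists_interp_eq_mk_subst H hΓ e.closed.lhs hV f
  obtain ⟨r, hr, hrf, hrb, hri⟩ := exists_interp_eq_mk_subst H hΓ e.closed.rhs hV f
  refine ⟨⟨∅, _, l, r, e.ε⟩, rfl, ?_, Set.disjoint_union_left.2 ⟨hlb, hrb⟩, fun Δ => ?_, ?_⟩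
  · rw [← e.fv_closed]
    simp only [QEq.fv, hlf, hrf]
    rfl
  · rw [← H.entails_closed (e := e)]
    exact ⟨fun h => h.congr hl.symm hr.symm, fun h => Entails.congr h hl hr⟩
  · rw [termAlg_holdsAt_iff H hΓ, hli, hri, edist_mk_le_iff]
    rfl

/-- At the assignment of each variable to itself, exactly the equations derivable from `Γ` hold in
the term model. -/
theorem termAlg_holdsAt_var_iff (H : HasLam Ax) (hΓ : (⋃ e ∈ Γ, e.fv).Finite) (e : QEq S) :
    (termAlg H Γ).HoldsAt (fun x => mk Ax Γ (.var x)) e ↔ Entails Ax Γ e := by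
  obtain ⟨e', -, -, -, h₁, h₂⟩ :=
    exists_termAlg_holdsAt_iff_entails H hΓ (fun x => .var x) Set.finite_empty e
  rw [h₂, ← h₁, QEq.subst, Tm.subst_var, Tm.subst_var]

/-- The term model satisfies every derivable inference with finitely many hypotheses. After closing
the equations and renaming their bound variables, the substitution rule applies to the
representatives of the values of an assignment. -/
theorem termAlg_models (H : HasLam Ax) (hΓ : (⋃ e ∈ Γ, e.fv).Finite) :
    (termAlg H Γ).Models (theoryOf Ax) := by
  intro p hp ρ hρ
  obtain ⟨f, rfl⟩ : ∃ f : ∀ x : Var T, LTm S x.1, ρ = fun x => mk Ax Γ (f x) :=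
    ⟨fun x => (ρ x).rep, by funext x; exact (mk_rep _).symm⟩
  have hV : (⋃ e ∈ insert p.2 (↑p.1 : Set (QEq S)), ⋃ x ∈ e.fv, (f x).fv).Finite :=
    (p.1.finite_toSet.insert p.2).biUnion fun e _ =>
      e.finite_fv.biUnion fun x _ => (f x).finite_fv
  choose v hvX hvfv hvbd hv hvf using exists_termAlg_holdsAt_iff_entails H hΓ f hV
  rw [hvf]
  have h₁ : Entails Ax (v '' ↑p.1) (v p.2) :=
    (hv _ _).2 (Entails.cut (fun e he => (hv e _).1 (Entails.assumpt ⟨e, he, rfl⟩)) hp)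
  refine Entails.cut ?_ (Entails.subst f ⟨by simp [hvX], ?_, ?_, ?_⟩ h₁)
  · rintro _ ⟨_, ⟨e, he, rfl⟩, rfl⟩
    exact (hvf e).1 (hρ e he)
  · rw [← Set.image_insert_eq]
    rintro _ ⟨e, he, rfl⟩ x hx - _ ⟨e', -, rfl⟩
    rw [hvfv] at hx
    refine ((hvbd e').mono_right ?_).symm
    exact (Set.subset_biUnion_of_mem (u := fun x => (f x).fv) hx).trans
      (Set.subset_biUnion_of_mem (u := fun e : QEq S => ⋃ x ∈ e.fv, (f x).fv) he)
  · rintro _ ⟨e, -, rfl⟩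
    simp [hvX]
  · rintro _ ⟨e, -, rfl⟩
    simp [hvX]

/-- Completeness, given that the term model belongs to the class `C` of algebras. -/
theorem entails_of_forall_sat (H : HasLam Ax) (Γ : Finset (QEq S)) (φ : QEq S)
    {C : AppAlg.{u, v, max u v} S → Prop} (hC : C (termAlg H ↑Γ))
    (h : ∀ A, C A → A.Models (theoryOf Ax) → A.Sat ↑Γ φ) : Entails Ax ↑Γ φ := by
  have hΓ : (⋃ e ∈ (↑Γ : Set (QEq S)), e.fv).Finite :=
    Γ.finite_toSet.biUnion fun e _ => e.finite_fv
  exact (termAlg_holdsAt_var_iff H hΓ φ).1 (h _ hC (termAlg_models H hΓ) _ fun e he =>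
    (termAlg_holdsAt_var_iff H hΓ e).2 (Entails.assumpt he))

end TermAlgebra

end QLam

theorem mainTheorem1 {T : Type u} (S : QLam.AppSig.{u, v} T) :
    (∀ U : Set (QLam.QInf S), QLam.IsLamTheory U →
      ∀ (Γ : Finset (QLam.QEq S)) (φ : QLam.QEq S),
        (Γ, φ) ∈ U ↔
          ∀ A : QLam.AppAlg.{u, v, max u v} S, A.IsLamAlgebra → A.Models U → A.Sat ↑Γ φ) ∧
    (∀ U : Set (QLam.QInf S), QLam.IsExtLamTheory U →
      ∀ (Γ : Finset (QLam.QEq S)) (φ : QLam.QEq S),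
        (Γ, φ) ∈ U ↔
          ∀ A : QLam.AppAlg.{u, v, max u v} S, A.IsExtLamAlgebra → A.Models U → A.Sat ↑Γ φ) := by
  have hfin : ∀ Γ : Finset (QLam.QEq S), (⋃ e ∈ (↑Γ : Set (QLam.QEq S)), e.fv).Finite :=
    fun Γ => Γ.finite_toSet.biUnion fun e _ => e.finite_fv
  constructor
  · rintro _ ⟨⟨Ax, rfl⟩, hU⟩ Γ φ
    have H : QLam.HasLam Ax := fun p hp => hU (QLam.Entails.ax (p := p) hp)
    exact ⟨fun h A _ hA => hA _ h, QLam.entails_of_forall_sat H Γ φ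
      ⟨_, QLam.termAlg_isRetraction H (hfin Γ)⟩⟩
  · rintro _ ⟨⟨Ax, rfl⟩, hU⟩ Γ φ
    have H : QLam.HasLam Ax := fun p hp => hU (QLam.Entails.ax (p := p) (Or.inl hp))
    have hη : ∀ p, QLam.EtaAx p → QLam.Entails Ax ↑p.1 p.2 :=
      fun p hp => hU (QLam.Entails.ax (p := p) (Or.inr hp))
    exact ⟨fun h A _ hA => hA _ h, QLam.entails_of_forall_sat H Γ φ
      ⟨_, QLam.termAlg_isRetraction H (hfin Γ), QLam.termAlg_isExt H (hfin Γ) hη⟩⟩
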